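/- **Conventions.** $\mathsf{LHomeo}$ is the class of pairs $(Y,\rho)$ with $Y$ a totally disconnected compact metrizable space and $\rho\colon Y\to Y$ a surjective local homeomorphism. A finite bipartite separated graph $(E,C)$ consists of finite sets $E^{0,0}$, $E^{0,1}$, $E^1$, surjective maps $r\colon E^1\to E^{0,0}$ and $s\colon E^1\to E^{0,1}$, and, for each $v\in E^{0,0}$, a partition $C_v$ of $r^{-1}(v)$ into non-empty sets. It is a *generalized finite shift graph* if $C_v=\{B_v,R_v\}$ with $B_v\neq R_v$ for all $v\in E^{0,0}$ (blue and red edges), $E^{0,1}=\bigsqcup_v s(B_v)=\bigcup_v s(R_v)$, and $s$ is injective on each $B_v$. Put $B=\bigsqcup_v B_v$. For $e\in B$ and $v\in E^{0,0}$ let $a_{e,v}$ be the number of $f\in R_v$ with $s(f)=s(e)$, and fix an enumeration $f_{e,v}^{(1)},\dots,f_{e,v}^{(a_{e,v})}$ of these red edges. **The generalized finite shift $(X,\sigma)$.** The one-step resolution $(E_1,C^1)$ of a finite bipartite separated graph $(E,C)$ has $E_1^{0,0}=E^{0,1}$; $E_1^{0,1}$ is the set of all $v(x)$, where $x=(x_Z)_{Z\in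 C_u}$ is a choice of an edge $x_Z\in Z$ for each $Z\in C_u$, for some $u\in E^{0,0}$; and for each such $x$ and each $Z\in C_u$ there is an edge $\alpha=(x,Z)$ with source $v(x)$ and range $s(x_Z)$; $x_Z$ is called the upper index of $\alpha$. For an edge $y$ of $E$, $X(y)$ is the set of the edges of $E_1$ with upper index $y$, and $C^1_w=\{X(y): s(y)=w\}$ for $w\in E_1^{0,0}$. Put $(E_0,C^0)=(E,C)$ and let $(E_{n+1},C^{n+1})$ be the one-step resolution of $(E_n,C^n)$, so $E_n^{0,1}=E_{n+1}^{0,0}$. For a generalized finite shift graph $(E,C)$, an edge of $E_{n+1}$ is blue (red) if its upper index is blue (red). A *romb* is a quadruple $(e_0,e_1,f_0,f_1)$ with $e_0,f_0\in E_n^1$, $e_1,f_1\in E_{n+1}^1$, $e_0,e_1$ blue, $f_0,f_1$ red, $s(e_0)=r(e_1)$, $s(f_0)=r(f_1)$, $r(e_0)=r(f_0)$, $s(e_1)=s(f_1)$. $X$ is the set of all sequences $(e_n)_{n\ge0}$ of blue edges $e_n\in E_n^1$ with $r(e_{n+1})=s(e_n)$ for all $n$, with the topology generated by the cylinder sets.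 For $x=(e_n)\in X$ and each $j\ge 0$ there are unique red edges $f_{2j},f_{2j+1}$ such that $(e_{2j},e_{2j+1},f_{2j},f_{2j+1})$ is a romb with $f_{2j+1}\in X(f_{2j})$; and $\sigma(x)=(e'_n)$ is the unique element of $X$ such that $(e'_{2j-1},e'_{2j},f_{2j-1},f_{2j})$ is a romb for all $j\ge1$ and $s(e'_0)=s(f_0)$. **$(E,C)$-structures.** An $(E,C)$-structure on $(Y,\rho)\in\mathsf{LHomeo}$ is a family of non-empty compact open sets $Z_e$ ($e\in B$) and $W_{e,v}^{(k)}$ ($e\in B$, $v\in E^{0,0}$, $1\le k\le a_{e,v}$) in $Y$ such that $Y=\bigsqcup_{e\in B}Z_e$, $\bigsqcup_{e\in B_v}Z_e=\bigsqcup_{e\in B}\bigsqcup_{k=1}^{a_{e,v}}W_{e,v}^{(k)}$ for each $v$, $\rho$ is injective on each $W_{e,v}^{(k)}$, and $\rho(W_{e,v}^{(k)})=Z_e$. The natural $(E,C)$-structure on $(X,\sigma)$ consists of $Z(e)=\{x\in X: x_0=e\}$ and of the sets $V_{e,v}^{(k)}$ of all $x\in X$ with $r(x_0)=v$ and $\sigma(x)\in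 Z(e)$ for which the romb $(x_0,x_1,f_0,f_1)$ with $f_1\in X(f_0)$ has $f_0=f_{e,v}^{(k)}$. **Theorem.** Let $(E,C)$ be a generalized finite shift graph. Then $(X,\sigma)\in\mathsf{LHomeo}$, the sets $Z(e)$, $V_{e,v}^{(k)}$ form an $(E,C)$-structure on $(X,\sigma)$, and this structure is universal: for every $(Y,\rho)\in\mathsf{LHomeo}$ and every $(E,C)$-structure $(\{Z_e\},\{W_{e,v}^{(k)}\})$ on $(Y,\rho)$ there is a unique continuous map $\psi\colon Y\to X$ such that $\psi(Z_e)\subseteq Z(e)$ and $\psi(W_{e,v}^{(k)})\subseteq V_{e,v}^{(k)}$ for all $e,v,k$, and $\psi\circ\rho=\sigma\circ\psi$. -/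

import Mathlib

open Set

universe u v

/-- A finite bipartite separated graph `(E, C)`.  The vertex set is the disjoint union of
`V₀` (the vertices `E^{0,0}`) and `V₁` (the vertices `E^{0,1}`), every edge goes from `V₁`
(its source) to `V₀` (its range), and `C v` is a partition of `r⁻¹(v)` into non-empty,
pairwise disjoint sets of edges. -/
structure BipSepGraph : Type (u + 1) where
  V₀ : Type u
  V₁ : Type u
  Edge : Type u
  finite_V₀ : Finite V₀
  finite_V₁ : Finite V₁
  finite_Edge : Finite Edge
  r : Edge → V₀
  s : Edge → V₁
  r_surjective : Function.Surjective r
  s_surjective : Function.Surjective s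
  C : V₀ → Set (Set Edge)
  nonempty_of_mem : ∀ v, ∀ X ∈ C v, X.Nonempty
  pairwiseDisjoint : ∀ v, (C v).PairwiseDisjoint id
  sUnion_eq : ∀ v, ⋃₀ C v = r ⁻¹' {v}

namespace BipSepGraph

/-- The choices `(x₁, …, x_k)` of one edge in every set of `C u`, for some `u : V₀`. -/
def Choice (G : BipSepGraph.{u}) : Type u :=
  Σ w : G.V₀, (X : ↥(G.C w)) → ↥(X : Set G.Edge)

/-- The edges of the one-step resolution.  The pair of a choice `(x₁, …, x_k)` and an index
`i` is the edge `α^{x_i}(x₁, …, x̂_i, …, x_k)`. -/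
def ResEdge (G : BipSepGraph.{u}) : Type u :=
  Σ c : G.Choice, ↥(G.C c.1)

/-- The upper index `x_i` of the edge `α^{x_i}(x₁, …, x̂_i, …, x_k)`. -/
def ResEdge.upper {G : BipSepGraph.{u}} (α : G.ResEdge) : G.Edge :=
  (α.1.2 α.2 : G.Edge)

/-- The set `X(x)` of all edges `α^{x}(…)` of the one-step resolution with upper index `x`. -/
def above (G : BipSepGraph.{u}) (x : G.Edge) : Set G.ResEdge :=
  {α | α.upper = x}

theorem r_of_mem (G : BipSepGraph.{u}) {w : G.V₀} {X : Set G.Edge} (hX : X ∈ G.C w)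
    {e : G.Edge} (he : e ∈ X) : G.r e = w := by
  have h : e ∈ ⋃₀ G.C w := ⟨X, hX, he⟩
  rw [G.sUnion_eq] at h
  exact h

theorem exists_mem (G : BipSepGraph.{u}) (e : G.Edge) : ∃ X ∈ G.C (G.r e), e ∈ X := by
  have h : e ∈ G.r ⁻¹' {G.r e} := rfl
  rw [← G.sUnion_eq] at h
  obtain ⟨X, hX, he⟩ := h
  exact ⟨X, hX, he⟩

theorem eq_of_mem (G : BipSepGraph.{u}) {w : G.V₀} {X Y : Set G.Edge} (hX : X ∈ G.C w)
    (hY : Y ∈ G.C w) {e : G.Edge} (heX : e ∈ X) (heY : e ∈ Y) : X = Y := by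
  by_contra hne
  exact Set.disjoint_left.1 (G.pairwiseDisjoint w hX hY hne) heX heY

theorem ResEdge.r_upper {G : BipSepGraph.{u}} (α : G.ResEdge) : G.r α.upper = α.1.1 :=
  G.r_of_mem α.2.2 (α.1.2 α.2).2

theorem ResEdge.r_upper_eq {G : BipSepGraph.{u}} {α β : G.ResEdge} (h : α.1 = β.1) :
    G.r α.upper = G.r β.upper := by
  rw [α.r_upper, β.r_upper, h]

theorem exists_choice (G : BipSepGraph.{u}) {w : G.V₀} {X : Set G.Edge} (hX : X ∈ G.C w)
    {x : G.Edge} (hx : x ∈ X) : ∃ α : G.ResEdge, α.upper = x := by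
  classical
  refine ⟨⟨⟨w, fun Y => if h : Y = ⟨X, hX⟩ then ⟨x, by rw [h]; exact hx⟩ else
    ⟨(G.nonempty_of_mem w Y.1 Y.2).some, (G.nonempty_of_mem w Y.1 Y.2).some_mem⟩⟩,
    ⟨X, hX⟩⟩, ?_⟩
  simp [ResEdge.upper]

theorem exists_upper (G : BipSepGraph.{u}) (x : G.Edge) : ∃ α : G.ResEdge, α.upper = x := by
  obtain ⟨X, hX, hx⟩ := G.exists_mem x
  exact G.exists_choice hX hx

/-- The one-step resolution `(E₁, C¹)` of a finite bipartite separated graph. -/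
def resolution (G : BipSepGraph.{u}) : BipSepGraph.{u} where
  V₀ := G.V₁
  V₁ := G.Choice
  Edge := G.ResEdge
  finite_V₀ := G.finite_V₁
  finite_V₁ := by
    have := G.finite_V₀
    have := G.finite_Edge
    unfold Choice
    infer_instance
  finite_Edge := by
    have := G.finite_V₀
    have := G.finite_Edge
    unfold ResEdge Choice
    infer_instance
  r := fun α => G.s α.upper
  s := fun α => α.1
  r_surjective := by
    intro w
    obtain ⟨x, rfl⟩ := G.s_surjective w
    obtain ⟨α, rfl⟩ := G.exists_upper x
    exact ⟨α, rfl⟩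
  s_surjective := by
    rintro ⟨w, c⟩
    obtain ⟨e, rfl⟩ := G.r_surjective w
    obtain ⟨X, hX, -⟩ := G.exists_mem e
    exact ⟨⟨⟨_, c⟩, ⟨X, hX⟩⟩, rfl⟩
  C := fun w => {Y | ∃ x, G.s x = w ∧ Y = G.above x}
  nonempty_of_mem := by
    rintro w Y ⟨x, -, rfl⟩
    exact G.exists_upper x
  pairwiseDisjoint := by
    rintro w Y ⟨x, -, rfl⟩ Y' ⟨x', -, rfl⟩ hne
    refine Set.disjoint_left.2 fun α (h : α.upper = x) (h' : α.upper = x') => hne ?_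
    rw [← h, ← h']
  sUnion_eq := by
    intro w
    ext α
    constructor
    · rintro ⟨Y, ⟨x, hx, rfl⟩, hα⟩
      change G.s α.upper = w
      rw [show α.upper = x from hα, hx]
    · intro h
      exact ⟨G.above α.upper, ⟨α.upper, h, rfl⟩, rfl⟩

/-- The `n`-step resolution `(E_n, C^n)`.  By construction the vertices `E_n^{0,1}` are the
vertices `E_{n+1}^{0,0}`, so that these graphs are the successive layers of a Bratteli diagram,
the canonical resolution of `(E, C)`. -/
def res (G : BipSepGraph.{u}) : ℕ → BipSepGraph.{u}
  | 0 => G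
  | n + 1 => (G.res n).resolution

/-- Extension of a set of edges to all layers: an edge of `E_{n+1}` in `X(x)` belongs to the
extension exactly when `x` does. -/
def extend (G : BipSepGraph.{u}) (P : Set G.Edge) : (n : ℕ) → Set (G.res n).Edge
  | 0 => P
  | n + 1 => {α : (G.res n).ResEdge | α.upper ∈ G.extend P n}

/-! Facts on sets of edges that are unions of sets of the partitions. -/

/-- `P` is a union of sets of the partitions `C v`. -/
def Saturated (G : BipSepGraph.{u}) (P : Set G.Edge) : Prop :=
  ∀ w, ∀ X ∈ G.C w, ∀ e ∈ X, ∀ e' ∈ X, e ∈ P → e' ∈ P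

/-- Every vertex in `V₁` emits exactly one edge of `P`. -/
def UniqueEdge (G : BipSepGraph.{u}) (P : Set G.Edge) : Prop :=
  ∀ w, ∃! e, G.s e = w ∧ e ∈ P

/-- For every vertex `w` in `V₀` exactly one set of the partition `C w` is contained in `P`. -/
def UniqueClass (G : BipSepGraph.{u}) (P : Set G.Edge) : Prop :=
  ∀ w, ∃! X, X ∈ G.C w ∧ X ⊆ P

theorem saturated_succ (G : BipSepGraph.{u}) (P : Set G.Edge) :
    G.resolution.Saturated {α : G.ResEdge | α.upper ∈ P} := by
  rintro w X ⟨x, -, rfl⟩ e (he : ResEdge.upper e = x) e' (he' : ResEdge.upper e' = x)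
    (h : ResEdge.upper e ∈ P)
  change ResEdge.upper e' ∈ P
  rw [he', ← he]
  exact h

theorem UniqueEdge.succ {G : BipSepGraph.{u}} {P : Set G.Edge} (h : G.UniqueEdge P) :
    G.resolution.UniqueClass {α : G.ResEdge | α.upper ∈ P} := by
  intro w
  obtain ⟨e, ⟨hs, hP⟩, huniq⟩ := h w
  refine ⟨G.above e, ⟨⟨e, hs, rfl⟩, ?_⟩, ?_⟩
  · intro α hα
    change ResEdge.upper α ∈ P
    rw [show ResEdge.upper α = e from hα]
    exact hP
  · rintro X ⟨⟨x, hx, rfl⟩, hX⟩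
    obtain ⟨α, hα⟩ := G.exists_upper x
    have h1 : ResEdge.upper α ∈ P := hX (show α ∈ G.above x from hα)
    rw [hα] at h1
    rw [huniq x ⟨hx, h1⟩]

theorem UniqueClass.succ {G : BipSepGraph.{u}} {P : Set G.Edge} (hP : G.Saturated P)
    (h : G.UniqueClass P) : G.resolution.UniqueEdge {α : G.ResEdge | α.upper ∈ P} := by
  intro c
  obtain ⟨X, ⟨hX, hXP⟩, huniq⟩ := h c.1
  refine ⟨⟨c, ⟨X, hX⟩⟩, ⟨rfl, hXP (c.2 ⟨X, hX⟩).2⟩, ?_⟩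
  rintro ⟨c', ⟨X', hX'⟩⟩ ⟨hc, hα⟩
  obtain rfl : c' = c := hc
  have : X' = X := huniq X' ⟨hX', fun e he => hP _ X' hX' _ (c'.2 ⟨X', hX'⟩).2 e he hα⟩
  subst this
  rfl

theorem saturated_extend (G : BipSepGraph.{u}) {P : Set G.Edge} (hP : G.Saturated P) :
    ∀ n, (G.res n).Saturated (G.extend P n)
  | 0 => hP
  | n + 1 => (G.res n).saturated_succ (G.extend P n)

end BipSepGraph

/-- A generalized finite shift graph: a finite bipartite separated graph with
`C v = {B v, R v}` (two distinct sets, the blue and the red edges with range `v`), such that the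
sets `s(B v)` form a disjoint decomposition of `E^{0,1}`, the sets `s(R v)` cover `E^{0,1}`, and
`s` is injective on every `B v`.  The sets `B v` and `R v` are non-empty because the members of
`C v` are. -/
structure GenFiniteShiftGraph : Type (u + 1) extends BipSepGraph.{u} where
  B : V₀ → Set Edge
  R : V₀ → Set Edge
  B_ne_R : ∀ w, B w ≠ R w
  C_eq : ∀ w, C w = {B w, R w}
  iUnion_s_B : ⋃ w, s '' B w = univ
  disjoint_s_B : Pairwise fun w w' => Disjoint (s '' B w) (s '' B w')
  iUnion_s_R : ⋃ w, s '' R w = univ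
  injOn_s_B : ∀ w, InjOn s (B w)

namespace GenFiniteShiftGraph

variable (G : GenFiniteShiftGraph.{u})

/-- The vertices of the layer `F^{0,n}` of the canonical resolution. -/
abbrev FVertex (n : ℕ) : Type u := (G.res n).V₀

/-- The edges of the layer `F^{1,n}` of the canonical resolution. -/
abbrev FEdge (n : ℕ) : Type u := (G.res n).Edge

/-- The range map `F^{1,n} → F^{0,n}`. -/
abbrev rg (n : ℕ) (e : G.FEdge n) : G.FVertex n := (G.res n).r e

/-- The source map `F^{1,n} → F^{0,n+1}`. -/
abbrev sc (n : ℕ) (e : G.FEdge n) : G.FVertex (n + 1) := (G.res n).s e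

/-- The blue edges of the layer `F^{1,n}`: in the layer `0` they are the elements of the sets
`B v`, and for a blue edge `e` all the edges in `X(e)` are blue. -/
def blue (n : ℕ) : Set (G.FEdge n) := G.extend {e | e ∈ G.B (G.r e)} n

/-- The red edges of the layer `F^{1,n}`: in the layer `0` they are the elements of the sets
`R v`, and for a red edge `f` all the edges in `X(f)` are red. -/
def red (n : ℕ) : Set (G.FEdge n) := G.extend {e | e ∈ G.R (G.r e)} n

/-- The set `R(f) = X(f)` of the separation at the vertex `s(f)`, for an edge `f`. -/
def RSet (n : ℕ) (f : G.FEdge n) : Set (G.FEdge (n + 1)) := (G.res n).above f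

/-- `(e₀, e₁, f₀, f₁)` is a romb: `(e₀, e₁)` and `(f₀, f₁)` are a blue and a red path of length
two with the same end points. -/
structure IsRomb (n : ℕ) (e₀ : G.FEdge n) (e₁ : G.FEdge (n + 1)) (f₀ : G.FEdge n)
    (f₁ : G.FEdge (n + 1)) : Prop where
  blue_e₀ : e₀ ∈ G.blue n
  blue_e₁ : e₁ ∈ G.blue (n + 1)
  red_f₀ : f₀ ∈ G.red n
  red_f₁ : f₁ ∈ G.red (n + 1)
  blue_path : G.sc n e₀ = G.rg (n + 1) e₁
  red_path : G.sc n f₀ = G.rg (n + 1) f₁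
  range_eq : G.rg n e₀ = G.rg n f₀
  source_eq : G.sc (n + 1) e₁ = G.sc (n + 1) f₁

/-- The space `X` of all infinite blue paths `(e₀, e₁, e₂, …)` of the canonical resolution. -/
def Path : Type u :=
  {e : (n : ℕ) → G.FEdge n //
    (∀ n, e n ∈ G.blue n) ∧ ∀ n, G.rg (n + 1) (e (n + 1)) = G.sc n (e n)}

/-- The topology of `X` as a subspace of the product of the finite discrete sets `F^{1,n}`; the
cylinder sets `{x | x₀ = e₀, …, x_n = e_n}` form a basis of it. -/
instance : TopologicalSpace G.Path :=
  TopologicalSpace.induced (fun x : G.Path => x.1)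
    (@Pi.topologicalSpace ℕ G.FEdge fun _ => ⊥)

/-- The relation `σ(x) = y`.  The edges `f₀ j` and `f₁ j` are the red edges `f_{2j}` and
`f_{2j+1}` of the rombs determined by the pairs `(x_{2j}, x_{2j+1})`. -/
def IsShift (x y : G.Path) : Prop :=
  ∃ (f₀ : (j : ℕ) → G.FEdge (2 * j)) (f₁ : (j : ℕ) → G.FEdge (2 * j + 1)),
    (∀ j, G.IsRomb (2 * j) (x.1 (2 * j)) (x.1 (2 * j + 1)) (f₀ j) (f₁ j) ∧
      f₁ j ∈ G.RSet (2 * j) (f₀ j)) ∧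
    (∀ j, G.IsRomb (2 * j + 1) (y.1 (2 * j + 1)) (y.1 (2 * j + 2)) (f₁ j) (f₀ (j + 1))) ∧
    G.sc 0 (y.1 0) = G.sc 0 (f₀ 0)

/-! The map `σ` is well defined. -/

theorem B_mem (w : G.V₀) : G.B w ∈ G.C w := by rw [G.C_eq]; simp

theorem R_mem (w : G.V₀) : G.R w ∈ G.C w := by rw [G.C_eq]; simp

theorem disjoint_B_R (w : G.V₀) : Disjoint (G.B w) (G.R w) :=
  G.pairwiseDisjoint w (G.B_mem w) (G.R_mem w) (G.B_ne_R w)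

theorem r_of_mem_B {w : G.V₀} {e : G.Edge} (h : e ∈ G.B w) : G.r e = w :=
  G.r_of_mem (G.B_mem w) h

theorem r_of_mem_R {w : G.V₀} {e : G.Edge} (h : e ∈ G.R w) : G.r e = w :=
  G.r_of_mem (G.R_mem w) h

theorem saturated_blue_zero : G.Saturated {e | e ∈ G.B (G.r e)} := by
  intro w X hX e he e' he' (h : e ∈ G.B (G.r e))
  rw [G.r_of_mem hX he] at h
  change e' ∈ G.B (G.r e')
  rw [G.r_of_mem hX he', ← G.eq_of_mem hX (G.B_mem w) he h]
  exact he'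

theorem saturated_red_zero : G.Saturated {e | e ∈ G.R (G.r e)} := by
  intro w X hX e he e' he' (h : e ∈ G.R (G.r e))
  rw [G.r_of_mem hX he] at h
  change e' ∈ G.R (G.r e')
  rw [G.r_of_mem hX he', ← G.eq_of_mem hX (G.R_mem w) he h]
  exact he'

theorem uniqueClass_blue_zero : G.UniqueClass {e | e ∈ G.B (G.r e)} := by
  intro w
  refine ⟨G.B w, ⟨G.B_mem w, fun e he => ?_⟩, ?_⟩
  · change e ∈ G.B (G.r e)
    rw [G.r_of_mem_B he]
    exact he
  · rintro X ⟨hX, hXB⟩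
    obtain ⟨e, he⟩ := G.nonempty_of_mem w X hX
    have h : e ∈ G.B (G.r e) := hXB he
    rw [G.r_of_mem hX he] at h
    exact G.eq_of_mem hX (G.B_mem w) he h

theorem uniqueClass_red_zero : G.UniqueClass {e | e ∈ G.R (G.r e)} := by
  intro w
  refine ⟨G.R w, ⟨G.R_mem w, fun e he => ?_⟩, ?_⟩
  · change e ∈ G.R (G.r e)
    rw [G.r_of_mem_R he]
    exact he
  · rintro X ⟨hX, hXR⟩
    obtain ⟨e, he⟩ := G.nonempty_of_mem w X hX
    have h : e ∈ G.R (G.r e) := hXR he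
    rw [G.r_of_mem hX he] at h
    exact G.eq_of_mem hX (G.R_mem w) he h

theorem uniqueEdge_blue_zero : G.UniqueEdge {e | e ∈ G.B (G.r e)} := by
  intro w
  have hw : w ∈ ⋃ u, G.s '' G.B u := by rw [G.iUnion_s_B]; trivial
  obtain ⟨u, e, he, rfl⟩ := Set.mem_iUnion.1 hw
  refine ⟨e, ⟨rfl, ?_⟩, ?_⟩
  · change e ∈ G.B (G.r e)
    rw [G.r_of_mem_B he]
    exact he
  · rintro e' ⟨hs, he' : e' ∈ G.B (G.r e')⟩
    have hr : G.r e' = u := by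
      by_contra hne
      exact Set.disjoint_left.1 (G.disjoint_s_B hne) ⟨e', he', hs⟩ ⟨e, he, rfl⟩
    rw [hr] at he'
    exact G.injOn_s_B u he' he hs

theorem blue_facts (n : ℕ) :
    (G.res n).UniqueEdge (G.blue n) ∧ (G.res n).UniqueClass (G.blue n) := by
  induction n with
  | zero => exact ⟨G.uniqueEdge_blue_zero, G.uniqueClass_blue_zero⟩
  | succ n ih =>
    exact ⟨ih.2.succ (G.saturated_extend G.saturated_blue_zero n), ih.1.succ⟩

theorem red_facts (j : ℕ) :
    (G.res (2 * j)).UniqueClass (G.red (2 * j)) ∧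
      (G.res (2 * j + 1)).UniqueEdge (G.red (2 * j + 1)) := by
  have step : ∀ j, (G.res (2 * j)).UniqueClass (G.red (2 * j)) →
      (G.res (2 * j + 1)).UniqueEdge (G.red (2 * j + 1)) := fun j h =>
    h.succ (G.saturated_extend G.saturated_red_zero (2 * j))
  induction j with
  | zero => exact ⟨G.uniqueClass_red_zero, step 0 G.uniqueClass_red_zero⟩
  | succ j ih => exact ⟨ih.2.succ, step (j + 1) ih.2.succ⟩

theorem blue_unique {n : ℕ} {e e' : G.FEdge n} (he : e ∈ G.blue n) (he' : e' ∈ G.blue n)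
    (h : G.sc n e = G.sc n e') : e = e' :=
  ((G.blue_facts n).1 (G.sc n e')).unique ⟨h, he⟩ ⟨rfl, he'⟩

theorem red_unique {j : ℕ} {f f' : G.FEdge (2 * j + 1)} (hf : f ∈ G.red (2 * j + 1))
    (hf' : f' ∈ G.red (2 * j + 1)) (h : G.sc (2 * j + 1) f = G.sc (2 * j + 1) f') : f = f' :=
  ((G.red_facts j).2 (G.sc (2 * j + 1) f')).unique ⟨h, hf⟩ ⟨rfl, hf'⟩

theorem exists_romb_even (j : ℕ) (e₀ : G.FEdge (2 * j)) (e₁ : G.FEdge (2 * j + 1))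
    (h₀ : e₀ ∈ G.blue (2 * j)) (h₁ : e₁ ∈ G.blue (2 * j + 1))
    (h : G.rg (2 * j + 1) e₁ = G.sc (2 * j) e₀) :
    ∃ f₀ f₁, G.IsRomb (2 * j) e₀ e₁ f₀ f₁ ∧ f₁ ∈ G.RSet (2 * j) f₀ := by
  obtain ⟨f₁, ⟨hs, hf₁⟩, -⟩ := (G.red_facts j).2 (G.sc (2 * j + 1) e₁)
  have hup : BipSepGraph.ResEdge.upper e₁ = e₀ := G.blue_unique h₁ h₀ h
  refine ⟨BipSepGraph.ResEdge.upper f₁, f₁, ⟨h₀, h₁, hf₁, hf₁, h.symm, rfl, ?_, hs.symm⟩, rfl⟩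
  rw [← hup]
  exact BipSepGraph.ResEdge.r_upper_eq hs.symm

theorem exists_romb_odd (j : ℕ) (f₀ : G.FEdge (2 * j + 1)) (f₁ : G.FEdge (2 * j + 2))
    (h₀ : f₀ ∈ G.red (2 * j + 1)) (h₁ : f₁ ∈ G.red (2 * j + 2))
    (h : G.sc (2 * j + 1) f₀ = G.rg (2 * j + 2) f₁) :
    ∃ e₀ e₁, G.IsRomb (2 * j + 1) e₀ e₁ f₀ f₁ := by
  obtain ⟨e₁, ⟨hs, he₁⟩, -⟩ := (G.blue_facts (2 * j + 2)).1 (G.sc (2 * j + 2) f₁)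
  have hup : BipSepGraph.ResEdge.upper f₁ = f₀ := G.red_unique h₁ h₀ h.symm
  refine ⟨BipSepGraph.ResEdge.upper e₁, e₁, ⟨he₁, he₁, h₀, h₁, rfl, h, ?_, hs⟩⟩
  rw [← hup]
  exact BipSepGraph.ResEdge.r_upper_eq hs

theorem exists_interleave {α : ℕ → Type u} (z : α 0) (a : (j : ℕ) → α (2 * j + 1))
    (b : (j : ℕ) → α (2 * j + 2)) :
    ∃ c : (n : ℕ) → α n, c 0 = z ∧ (∀ j, c (2 * j + 1) = a j) ∧ ∀ j, c (2 * j + 2) = b j := by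
  have key : ∀ n, ∃ c : α n, (∀ h : n = 0, h ▸ c = z) ∧ (∀ j, ∀ h : n = 2 * j + 1, h ▸ c = a j) ∧
      ∀ j, ∀ h : n = 2 * j + 2, h ▸ c = b j := by
    intro n
    have hn : n = 0 ∨ (∃ j, n = 2 * j + 1) ∨ ∃ j, n = 2 * j + 2 := by
      rcases Nat.even_or_odd' n with ⟨k, rfl | rfl⟩
      · cases k with
        | zero => exact Or.inl rfl
        | succ k => exact Or.inr (Or.inr ⟨k, rfl⟩)
      · exact Or.inr (Or.inl ⟨k, rfl⟩)
    rcases hn with rfl | ⟨j, rfl⟩ | ⟨j, rfl⟩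
    · exact ⟨z, fun _ => rfl, fun j h => by omega, fun j h => by omega⟩
    · refine ⟨a j, fun h => by omega, fun i h => ?_, fun i h => by omega⟩
      obtain rfl : j = i := by omega
      rfl
    · refine ⟨b j, fun h => by omega, fun i h => by omega, fun i h => ?_⟩
      obtain rfl : j = i := by omega
      rfl
  choose c h0 h1 h2 using key
  exact ⟨c, h0 0 rfl, fun j => h1 _ j rfl, fun j => h2 _ j rfl⟩

theorem existsUnique_shift (x : G.Path) : ∃! y, G.IsShift x y := by
  choose f₀ f₁ hf using fun j =>
    G.exists_romb_even j (x.1 (2 * j)) (x.1 (2 * j + 1)) (x.2.1 _) (x.2.1 _) (x.2.2 _)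
  have hcomp : ∀ j, G.sc (2 * j + 1) (f₁ j) = G.rg (2 * j + 2) (f₀ (j + 1)) := by
    intro j
    rw [← (hf j).1.source_eq]
    exact ((x.2.2 (2 * j + 1)).symm).trans (hf (j + 1)).1.range_eq
  choose y₁ y₂ hy using fun j =>
    G.exists_romb_odd j (f₁ j) (f₀ (j + 1)) (hf j).1.red_f₁ (hf (j + 1)).1.red_f₀ (hcomp j)
  obtain ⟨y₀, ⟨hs₀, hb₀⟩, -⟩ := (G.blue_facts 0).1 (G.sc 0 (f₀ 0))
  obtain ⟨y, hy0, hyo, hye⟩ := exists_interleave (α := G.FEdge) y₀ y₁ y₂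
  have hcase : ∀ n : ℕ, n = 0 ∨ (∃ j, n = 2 * j + 1) ∨ ∃ j, n = 2 * j + 2 := by
    intro n
    rcases Nat.even_or_odd' n with ⟨k, rfl | rfl⟩
    · cases k with
      | zero => exact Or.inl rfl
      | succ k => exact Or.inr (Or.inr ⟨k, rfl⟩)
    · exact Or.inr (Or.inl ⟨k, rfl⟩)
  have hblue : ∀ n, y n ∈ G.blue n := by
    intro n
    rcases hcase n with rfl | ⟨j, rfl⟩ | ⟨j, rfl⟩
    · rw [hy0]; exact hb₀
    · rw [hyo]; exact (hy j).blue_e₀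
    · rw [hye]; exact (hy j).blue_e₁
  have hpath : ∀ n, G.rg (n + 1) (y (n + 1)) = G.sc n (y n) := by
    intro n
    rcases hcase n with rfl | ⟨j, rfl⟩ | ⟨j, rfl⟩
    · rw [hy0, show y (0 + 1) = y₁ 0 from hyo 0]
      exact ((hy 0).range_eq.trans (hf 0).1.red_path.symm).trans hs₀.symm
    · rw [hyo, show y (2 * j + 1 + 1) = y₂ j from hye j]
      exact (hy j).blue_path.symm
    · rw [hye, show y (2 * j + 2 + 1) = y₁ (j + 1) from hyo (j + 1)]
      exact ((hy (j + 1)).range_eq.trans (hf (j + 1)).1.red_path.symm).trans (hy j).source_eq.symm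
  refine ⟨⟨y, hblue, hpath⟩, ⟨f₀, f₁, hf, fun j => ?_, ?_⟩, ?_⟩
  · change G.IsRomb (2 * j + 1) (y (2 * j + 1)) (y (2 * j + 2)) (f₁ j) (f₀ (j + 1))
    rw [hyo, hye]
    exact hy j
  · change G.sc 0 (y 0) = _
    rw [hy0]
    exact hs₀
  · rintro z ⟨g₀, g₁, hg, hz, hz0⟩
    have hg₁ : ∀ j, g₁ j = f₁ j := fun j =>
      G.red_unique (hg j).1.red_f₁ (hf j).1.red_f₁
        ((hg j).1.source_eq.symm.trans (hf j).1.source_eq)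
    have hg₀ : ∀ j, g₀ j = f₀ j := by
      intro j
      rw [← show BipSepGraph.ResEdge.upper (g₁ j) = g₀ j from (hg j).2,
        ← show BipSepGraph.ResEdge.upper (f₁ j) = f₀ j from (hf j).2, hg₁]
    have hz2 : ∀ j, z.1 (2 * j + 2) = y₂ j := by
      intro j
      refine G.blue_unique (hz j).blue_e₁ (hy j).blue_e₁ ?_
      have := (hz j).source_eq
      rw [hg₀] at this
      exact this.trans (hy j).source_eq.symm
    have hz1 : ∀ j, z.1 (2 * j + 1) = y₁ j := by
      intro j
      refine G.blue_unique (hz j).blue_e₀ (hy j).blue_e₀ ?_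
      have := (hz j).blue_path
      rw [show z.1 (2 * j + 1 + 1) = y₂ j from hz2 j] at this
      exact this.trans (hy j).blue_path.symm
    refine Subtype.ext (funext fun n => ?_)
    change z.1 n = y n
    rcases hcase n with rfl | ⟨j, rfl⟩ | ⟨j, rfl⟩
    · rw [hy0]
      refine G.blue_unique (z.2.1 0) hb₀ ?_
      rw [hz0, hg₀]
      exact hs₀.symm
    · rw [hyo, hz1]
    · rw [hye, hz2]

/-- The map `σ : X → X` of the generalized finite shift `(X, σ)`: the blue path `σ(x)` is
determined by the red edges of the rombs of `x`. -/
noncomputable def shift (x : G.Path) : G.Path :=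
  (G.existsUnique_shift x).choose

theorem isShift_shift (x : G.Path) : G.IsShift x (G.shift x) :=
  (G.existsUnique_shift x).choose_spec.1

end GenFiniteShiftGraph

/-- `(X, σ)` belongs to the class `LHomeo`. -/
structure IsLHomeo {X : Type v} [TopologicalSpace X] (σ : X → X) : Prop where
  compact : CompactSpace X
  totallyDisconnected : TotallyDisconnectedSpace X
  metrizable : TopologicalSpace.MetrizableSpace X
  surjective : Function.Surjective σ
  isLocalHomeomorph : IsLocalHomeomorph σ

/-- `({Z γ}, {V γ i k})` is a `σ`-cylinder decomposition of `X`.  The decomposition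
`Γ = ⨆ Γ_i` into non-empty sets is given by the surjective map `p : Γ → I` with fibres `Γ_i`. -/
structure IsCylinderDecomposition {X : Type v} [TopologicalSpace X] (σ : X → X)
    {Γ I : Type u} (p : Γ → I) (a : Γ → I → ℕ) (Z : Γ → Set X)
    (V : (γ : Γ) → (i : I) → Fin (a γ i) → Set X) : Prop where
  finite : Finite Γ
  surjective : Function.Surjective p
  Z_nonempty : ∀ γ, (Z γ).Nonempty
  Z_compact : ∀ γ, IsCompact (Z γ)
  Z_open : ∀ γ, IsOpen (Z γ)
  Z_disjoint : Pairwise fun γ γ' => Disjoint (Z γ) (Z γ')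
  V_nonempty : ∀ γ i k, (V γ i k).Nonempty
  V_compact : ∀ γ i k, IsCompact (V γ i k)
  V_open : ∀ γ i k, IsOpen (V γ i k)
  iUnion_Z : ⋃ γ, Z γ = univ
  iUnion_V : ∀ i, ⋃ γ, ⋃ k, V γ i k = ⋃ γ, ⋃ (_ : p γ = i), Z γ
  V_disjoint : ∀ i, Pairwise fun q q' : (Σ γ, Fin (a γ i)) =>
    Disjoint (V q.1 i q.2) (V q'.1 i q'.2)
  injOn : ∀ γ i k, InjOn σ (V γ i k)
  image_eq : ∀ γ i k, σ '' V γ i k = Z γ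

namespace GenFiniteShiftGraph

variable (G : GenFiniteShiftGraph.{u})

/-- The set of all blue edges of `E`. -/
def BlueEdge : Type u := {e : G.Edge // e ∈ G.B (G.r e)}

/-- The set of the red edges from `s(e)` to `w`, for a blue edge `e` and a vertex `w`. -/
def RedFrom (e : G.BlueEdge) (w : G.V₀) : Type u := {f : G.Edge // f ∈ G.R w ∧ G.s f = G.s e.1}

/-- The red adjacency matrix: the number `a_{e,w}` of red edges from `s(e)` to `w`. -/
noncomputable def redAdj (e : G.BlueEdge) (w : G.V₀) : ℕ := Nat.card (G.RedFrom e w)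

/-- A labelling `f_{e,w}^{(k)}`, `k < a_{e,w}`, of the red edges of `E`. -/
abbrev RedLabelling : Type u :=
  (e : G.BlueEdge) → (w : G.V₀) → Fin (G.redAdj e w) ≃ G.RedFrom e w

/-- `({Z e}, {W e w k})` is an `(E, C)`-structure on `(Y, ρ)`. -/
def IsStructure {Y : Type v} [TopologicalSpace Y] (ρ : Y → Y) (Z : G.BlueEdge → Set Y)
    (W : (e : G.BlueEdge) → (w : G.V₀) → Fin (G.redAdj e w) → Set Y) : Prop :=
  IsCylinderDecomposition ρ (fun e : G.BlueEdge => G.r e.1) G.redAdj Z W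

/-- A map `ψ : Y' → Y` is `(E, C)`-equivariant. -/
structure IsEquivariant {Y' Y : Type*} (ρ' : Y' → Y') (Z' : G.BlueEdge → Set Y')
    (W' : (e : G.BlueEdge) → (w : G.V₀) → Fin (G.redAdj e w) → Set Y')
    (ρ : Y → Y) (Z : G.BlueEdge → Set Y)
    (W : (e : G.BlueEdge) → (w : G.V₀) → Fin (G.redAdj e w) → Set Y)
    (ψ : Y' → Y) : Prop where
  image_Z : ∀ e, ψ '' Z' e ⊆ Z e
  image_W : ∀ e w k, ψ '' W' e w k ⊆ W e w k
  comm : ψ ∘ ρ' = ρ ∘ ψ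

/-- The sets `Z(e) = {x | x₀ = e}` of the natural `(E, C)`-structure on `(X, σ)`. -/
def natZ (e : G.BlueEdge) : Set G.Path := {x | x.1 0 = e.1}

/-- The sets `V_{e,w}^{(k)}` of the natural `(E, C)`-structure on `(X, σ)`: the set of all
`x ∈ Z(w)` with `σ(x) ∈ Z(e)` for which the romb `(x₀, x₁, f₀, f₁)` of the pair `(x₀, x₁)` has
the first red edge `f₀ = f_{e,w}^{(k)}`. -/
def natW (lab : G.RedLabelling) (e : G.BlueEdge) (w : G.V₀) (k : Fin (G.redAdj e w)) :
    Set G.Path :=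
  {x | G.rg 0 (x.1 0) = w ∧ G.shift x ∈ G.natZ e ∧
    ∃ f₁ : G.FEdge 1, G.IsRomb 0 (x.1 0) (x.1 1) (lab e w k).1 f₁ ∧
      f₁ ∈ G.RSet 0 (lab e w k).1}

/-- The universal property of an `(E, C)`-structure `({Z e}, {W e w k})` on `(X, σ)`, with respect
to all `(E, C)`-structures on objects of `LHomeo` (whose spaces are types in the universe `v`). -/
def IsUniversal {X : Type u} [TopologicalSpace X] (σ : X → X) (Z : G.BlueEdge → Set X)
    (W : (e : G.BlueEdge) → (w : G.V₀) → Fin (G.redAdj e w) → Set X) : Prop :=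
  ∀ (Y : Type v) [TopologicalSpace Y] (ρ : Y → Y), IsLHomeo ρ →
    ∀ (Z' : G.BlueEdge → Set Y) (W' : (e : G.BlueEdge) → (w : G.V₀) → Fin (G.redAdj e w) → Set Y),
      G.IsStructure ρ Z' W' →
        ∃! ψ : Y → X, Continuous ψ ∧ G.IsEquivariant ρ Z' W' σ Z W ψ

end GenFiniteShiftGraph

/-! Since every vertex emits exactly one blue edge, a path is the same thing as the sequence of the
sources of its edges, and each of these vertices determines all earlier ones. In odd layers the red
edge with a given source is also unique. A path `x` therefore carries red edges `redOdd j` and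
`redEven j`, each the upper index of the next, and the even vertices of `shift x` are the sources of
the edges `redEven j` (`vtx_shift`).

The natural structure rests on the fact that an edge of the two-step resolution amounts to a choice
together with an edge `z` whose source is the base vertex of that choice. The sources of the edges
`redEven j` are read off from `shift x`, so `x` is determined by the pair (`shift x`, `redEven 0`)
(`eq_of_shift_eq`), and every pair of a path `y` and a red edge with source `s(y₀)` occurs
(`exists_shift_eq`). Hence `shift` maps each set `{redEven 0 = f}` bijectively onto a cylinder set,
and these sets are the `V_{e,v}^{(k)}` (`mem_natW_iff`).

For universality, an `(E, C)`-structure is read as an action of the graph by partial homeomorphisms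
between two copies of `Y`: blue edges act as identities on the sets `Z_e`, red ones as `ρ` on the
sets `W_{e,v}^{(k)}`. Such an action passes to the one-step resolution: a point is assigned the
choice of edges defined at it, and the action is inverted. Throughout the iteration blue edges act
as identities, and red edges as restrictions of `ρ` in even layers and of its inverse in odd ones.
The vertices carrying `y` in the successive layers form the path `toPath y`. Uniqueness is an
induction over the layers: an equivariant map agrees with `toPath` on layer `0`, and the vertex in
the next layer is the tuple of edges acting on the point, which equivariance forces (`eq_toPath`).
-/

namespace BipSepGraph

/-! ### Edges and choices in one and two resolution steps -/

variable {H : BipSepGraph.{u}}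

/-- An edge of the one-step resolution is determined by its source and its upper index. -/
theorem ResEdge.eq_of_source_of_upper {α β : H.ResEdge} (hs : α.1 = β.1)
    (hu : α.upper = β.upper) : α = β := by
  obtain ⟨c, X, hX⟩ := α
  obtain ⟨c', X', hX'⟩ := β
  obtain rfl : c = c' := hs
  have : X = X' := H.eq_of_mem hX hX' (c.2 ⟨X, hX⟩).2 (by
    rw [show (c.2 ⟨X, hX⟩ : H.Edge) = (c.2 ⟨X', hX'⟩ : H.Edge) from hu]
    exact (c.2 ⟨X', hX'⟩).2)
  subst this
  rfl

theorem ResEdge.choice_apply (β : H.ResEdge) {X : Set H.Edge} (hX : X ∈ H.C β.1.1)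
    (h : β.upper ∈ X) : (β.1.2 ⟨X, hX⟩ : H.Edge) = β.upper := by
  obtain ⟨c, X', hX'⟩ := β
  have : X = X' := H.eq_of_mem hX hX' h (c.2 ⟨X', hX'⟩).2
  subst this
  rfl

/-- An edge with source `c'` has one of the components of `c'` as its upper index, and that
component is the one for the class containing it. This allows choices to be compared without
transporting along `h`. -/
theorem Choice.eq_of_forall {c c' : H.Choice} (h : c.1 = c'.1)
    (hX : ∀ X (hX : X ∈ H.C c.1), ∃ β : H.ResEdge, β.1 = c' ∧ β.upper = (c.2 ⟨X, hX⟩ : H.Edge)) :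
    c = c' := by
  obtain ⟨w, g⟩ := c
  obtain ⟨w', g'⟩ := c'
  obtain rfl : w = w' := h
  congr 1
  funext ⟨X, hXw⟩
  obtain ⟨⟨c, X'⟩, rfl, hu⟩ := hX X hXw
  apply Subtype.ext
  rw [← show ResEdge.upper _ = (g ⟨X, hXw⟩ : H.Edge) from hu]
  exact (ResEdge.choice_apply _ hXw (by rw [hu]; exact (g ⟨X, hXw⟩).2)).symm

/-- An edge `z` and a choice in the one-step resolution at the vertex `s(z)` determine an edge
of the two-step resolution. -/
theorem exists_upper_upper_eq (z : H.Edge) (c : H.resolution.Choice) (h : c.1 = H.s z) :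
    ∃ β : H.resolution.ResEdge, β.1 = c ∧ ResEdge.upper (G := H) (ResEdge.upper β) = z := by
  refine ⟨⟨c, ⟨H.above z, z, h.symm, rfl⟩⟩, rfl, ?_⟩
  exact (c.2 ⟨H.above z, z, h.symm, rfl⟩).2

/-- The classes of the resolution are the sets `above x`, and the class of `β` is recovered from the
upper index of its upper index. -/
theorem eq_of_upper_upper_eq {β β' : H.resolution.ResEdge} (hs : β.1 = β'.1)
    (h : ResEdge.upper (G := H) (ResEdge.upper β) = ResEdge.upper (G := H) (ResEdge.upper β')) :
    β = β' := by
  obtain ⟨c, X, x, hx, rfl⟩ := β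
  obtain ⟨c', X', x', hx', rfl⟩ := β'
  obtain rfl : c = c' := hs
  have h1 : x = x' := by
    rw [← show ResEdge.upper (G := H) _ = x from (c.2 ⟨H.above x, x, hx, rfl⟩).2,
      ← show ResEdge.upper (G := H) _ = x' from (c.2 ⟨H.above x', x', hx', rfl⟩).2]
    exact h
  subst h1
  rfl

end BipSepGraph

/-! ### Paths coded by vertices, and their red edges -/

namespace GenFiniteShiftGraph

open BipSepGraph

variable (G : GenFiniteShiftGraph.{u})

/-- The unique blue edge with a given source. -/
noncomputable def blueEdge (n : ℕ) (w : G.FVertex (n + 1)) : G.FEdge n :=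
  ((G.blue_facts n).1 w).choose

variable {G}

theorem sc_blueEdge (n : ℕ) (w : G.FVertex (n + 1)) : G.sc n (G.blueEdge n w) = w :=
  ((G.blue_facts n).1 w).choose_spec.1.1

theorem blueEdge_mem (n : ℕ) (w : G.FVertex (n + 1)) : G.blueEdge n w ∈ G.blue n :=
  ((G.blue_facts n).1 w).choose_spec.1.2

theorem blueEdge_eq {n : ℕ} {e : G.FEdge n} (he : e ∈ G.blue n) {w : G.FVertex (n + 1)}
    (h : G.sc n e = w) : G.blueEdge n w = e :=
  G.blue_unique (blueEdge_mem n w) he ((sc_blueEdge n w).trans h.symm)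

variable (G) in
/-- The unique red edge with a given source in an odd layer. -/
noncomputable def redEdge (j : ℕ) (w : G.FVertex (2 * j + 2)) : G.FEdge (2 * j + 1) :=
  ((G.red_facts j).2 w).choose

theorem sc_redEdge (j : ℕ) (w : G.FVertex (2 * j + 2)) :
    G.sc (2 * j + 1) (G.redEdge j w) = w :=
  ((G.red_facts j).2 w).choose_spec.1.1

theorem redEdge_mem (j : ℕ) (w : G.FVertex (2 * j + 2)) : G.redEdge j w ∈ G.red (2 * j + 1) :=
  ((G.red_facts j).2 w).choose_spec.1.2

theorem redEdge_eq {j : ℕ} {f : G.FEdge (2 * j + 1)} (hf : f ∈ G.red (2 * j + 1))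
    {w : G.FVertex (2 * j + 2)} (h : G.sc (2 * j + 1) f = w) : G.redEdge j w = f :=
  G.red_unique (redEdge_mem j w) hf ((sc_redEdge j w).trans h.symm)

/-- The upper index of an edge in a positive layer. -/
def upper {n : ℕ} (e : G.FEdge (n + 1)) : G.FEdge n :=
  ResEdge.upper (G := G.res n) e

theorem rg_upper {n : ℕ} (e : G.FEdge (n + 1)) :
    G.rg n (upper e) = (show (G.res n).Choice from G.sc (n + 1) e).1 :=
  ResEdge.r_upper (G := G.res n) e

theorem rg_upper_congr {n : ℕ} {e e' : G.FEdge (n + 1)} (h : G.sc (n + 1) e = G.sc (n + 1) e') :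
    G.rg n (upper e) = G.rg n (upper e') :=
  ResEdge.r_upper_eq (G := G.res n) h

theorem blue_upper {n : ℕ} {e : G.FEdge (n + 1)} : upper e ∈ G.blue n ↔ e ∈ G.blue (n + 1) :=
  Iff.rfl

theorem red_upper {n : ℕ} {e : G.FEdge (n + 1)} : upper e ∈ G.red n ↔ e ∈ G.red (n + 1) :=
  Iff.rfl

theorem edge_ext {n : ℕ} {e e' : G.FEdge (n + 1)} (hs : G.sc (n + 1) e = G.sc (n + 1) e')
    (hu : upper e = upper e') : e = e' :=
  ResEdge.eq_of_source_of_upper (H := G.res n) hs hu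

theorem blue_or_red : ∀ (n : ℕ) (e : G.FEdge n), e ∈ G.blue n ∨ e ∈ G.red n
  | 0, e => by
    obtain ⟨X, hX, he⟩ := G.exists_mem e
    rw [G.C_eq] at hX
    rcases hX with rfl | rfl
    · exact Or.inl he
    · exact Or.inr he
  | n + 1, e => blue_or_red n (upper e)

theorem upper_blue_eq {n : ℕ} {e : G.FEdge (n + 1)} (he : e ∈ G.blue (n + 1)) {e' : G.FEdge n}
    (he' : e' ∈ G.blue n) (h : G.rg (n + 1) e = G.sc n e') : upper e = e' :=
  G.blue_unique (blue_upper.2 he) he' h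

namespace Path

/-- The source of the `n`-th edge of a path. -/
def vtx (x : G.Path) (n : ℕ) : G.FVertex (n + 1) := G.sc n (x.1 n)

theorem edge_eq (x : G.Path) (n : ℕ) : x.1 n = G.blueEdge n (x.vtx n) :=
  (blueEdge_eq (x.2.1 n) rfl).symm

theorem upper_edge (x : G.Path) (n : ℕ) : upper (x.1 (n + 1)) = x.1 n :=
  upper_blue_eq (x.2.1 _) (x.2.1 _) (x.2.2 n)

theorem ext_vtx {x y : G.Path} (h : ∀ n, x.vtx n = y.vtx n) : x = y := by
  refine Subtype.ext (funext fun n => ?_)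
  rw [edge_eq, edge_eq, h]

theorem rg_blueEdge_vtx (x : G.Path) (n : ℕ) :
    G.rg (n + 1) (G.blueEdge (n + 1) (x.vtx (n + 1))) = x.vtx n := by
  rw [← edge_eq]
  exact x.2.2 n

theorem ext_vtx_even {x y : G.Path} (h : ∀ j, x.vtx (2 * j) = y.vtx (2 * j)) : x = y := by
  refine ext_vtx fun n => ?_
  rcases Nat.even_or_odd' n with ⟨k, rfl | rfl⟩
  · exact h k
  · rw [← rg_blueEdge_vtx x, ← rg_blueEdge_vtx y]
    exact congrArg (fun w => G.rg (2 * k + 2) (G.blueEdge (2 * k + 2) w)) (h (k + 1))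

theorem ext_vtx_odd {x y : G.Path} (h : ∀ j, x.vtx (2 * j + 1) = y.vtx (2 * j + 1)) :
    x = y := by
  refine ext_vtx fun n => ?_
  rcases Nat.even_or_odd' n with ⟨k, rfl | rfl⟩
  · rw [← rg_blueEdge_vtx x, ← rg_blueEdge_vtx y, h]
  · exact h k

/-- The path through a compatible sequence of vertices. -/
noncomputable def ofVtx (w : (n : ℕ) → G.FVertex (n + 1))
    (h : ∀ n, G.rg (n + 1) (G.blueEdge (n + 1) (w (n + 1))) = w n) : G.Path :=
  ⟨fun n => G.blueEdge n (w n), fun n => blueEdge_mem n _, fun n => by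
    rw [h, sc_blueEdge]⟩

theorem vtx_ofVtx (w : (n : ℕ) → G.FVertex (n + 1))
    (h : ∀ n, G.rg (n + 1) (G.blueEdge (n + 1) (w (n + 1))) = w n) (n : ℕ) :
    (ofVtx w h).vtx n = w n :=
  sc_blueEdge n (w n)

/-- The red edges `f_{2j+1}` of a path. -/
noncomputable def redOdd (x : G.Path) (j : ℕ) : G.FEdge (2 * j + 1) :=
  G.redEdge j (x.vtx (2 * j + 1))

/-- The red edges `f_{2j}` of a path. -/
noncomputable def redEven (x : G.Path) (j : ℕ) : G.FEdge (2 * j) := upper (x.redOdd j)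

theorem sc_redOdd (x : G.Path) (j : ℕ) : G.sc (2 * j + 1) (x.redOdd j) = x.vtx (2 * j + 1) :=
  sc_redEdge j _

theorem redOdd_mem (x : G.Path) (j : ℕ) : x.redOdd j ∈ G.red (2 * j + 1) := redEdge_mem j _

theorem redEven_mem (x : G.Path) (j : ℕ) : x.redEven j ∈ G.red (2 * j) := redEdge_mem j _

theorem rg_redEven (x : G.Path) (j : ℕ) :
    G.rg (2 * j) (x.redEven j) = G.rg (2 * j) (x.1 (2 * j)) := by
  rw [← upper_edge]
  exact rg_upper_congr (x.sc_redOdd j)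

theorem upper_redEven (x : G.Path) (j : ℕ) : upper (x.redEven (j + 1)) = x.redOdd j := by
  refine (redEdge_eq (j := j) (x.redEven_mem (j + 1)) ?_).symm
  exact (x.rg_redEven (j + 1)).trans (x.2.2 (2 * j + 1))

/-- The rombs of `x` have no freedom: their red edges are `redOdd` and `redEven`. The converse
follows from the existence of the shift, because even vertices determine a path. -/
theorem shift_isShift_iff {x y : G.Path} :
    G.IsShift x y ↔ ∀ j, y.vtx (2 * j) = G.sc (2 * j) (x.redEven j) := by
  have key : ∀ y, G.IsShift x y → ∀ j, y.vtx (2 * j) = G.sc (2 * j) (x.redEven j) := by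
    rintro y ⟨f₀, f₁, hf, hy, h0⟩ j
    have h1 : ∀ j, f₀ j = x.redEven j := fun j => by
      have h := redEdge_eq (hf j).1.red_f₁ (hf j).1.source_eq.symm
      have h' : upper (f₁ j) = f₀ j := (hf j).2
      rw [← h', ← h]
      rfl
    rw [← h1]
    cases j with
    | zero => exact h0
    | succ j => exact (hy j).source_eq
  refine ⟨key y, fun h => ?_⟩
  have hs := G.isShift_shift x
  have : G.shift x = y := ext_vtx_even fun j => (key _ hs j).trans (h j).symm
  rwa [this] at hs

theorem vtx_shift (x : G.Path) (j : ℕ) :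
    (G.shift x).vtx (2 * j) = G.sc (2 * j) (x.redEven j) :=
  shift_isShift_iff.1 (G.isShift_shift x) j

theorem shift_eq {x y : G.Path} (h : ∀ j, y.vtx (2 * j) = G.sc (2 * j) (x.redEven j)) :
    G.shift x = y :=
  ext_vtx_even fun j => (vtx_shift x j).trans (h j).symm

/-- By induction all the edges `redEven j` agree: the source of `redEven (j + 1)` is a vertex of the
shifted path, and its twofold upper index is `redEven j`. -/
theorem eq_of_shift_eq {x y : G.Path} (h : G.shift x = G.shift y)
    (h0 : x.redEven 0 = y.redEven 0) : x = y := by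
  have key : ∀ j, x.redEven j = y.redEven j := by
    intro j
    induction j with
    | zero => exact h0
    | succ j ih =>
      refine eq_of_upper_upper_eq (H := G.res (2 * j)) ?_ ?_
      · change G.sc (2 * (j + 1)) (x.redEven (j + 1)) = G.sc (2 * (j + 1)) (y.redEven (j + 1))
        rw [← vtx_shift, ← vtx_shift, h]
      · change upper (upper (x.redEven (j + 1))) = upper (upper (y.redEven (j + 1)))
        rw [upper_redEven, upper_redEven]
        exact ih
  refine ext_vtx_odd fun j => ?_
  rw [← sc_redOdd, ← sc_redOdd, ← upper_redEven, ← upper_redEven, key]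

theorem choice_vtx (y : G.Path) (n : ℕ) :
    (show (G.res (n + 1)).Choice from y.vtx (n + 2)).1 = y.vtx n := by
  refine (rg_upper (y.1 (n + 2))).symm.trans ?_
  rw [upper_edge]
  exact y.2.2 n

/-- Every red edge with source `s(y₀)` determines a preimage of the path `y`. -/
theorem exists_shift_eq (y : G.Path) (f : G.FEdge 0) (hf : f ∈ G.red 0)
    (h : G.sc 0 f = y.vtx 0) : ∃ x : G.Path, G.shift x = y ∧ x.redEven 0 = f := by
  have step : ∀ j (g : {g : G.FEdge (2 * j) // g ∈ G.red (2 * j) ∧ G.sc (2 * j) g = y.vtx (2 * j)}),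
      ∃ g' : {g' : G.FEdge (2 * (j + 1)) // g' ∈ G.red (2 * (j + 1)) ∧
        G.sc (2 * (j + 1)) g' = y.vtx (2 * (j + 1))},
        upper (n := 2 * j) (upper (n := 2 * j + 1) g'.1) = g.1 := by
    rintro j ⟨g, hg, hs⟩
    obtain ⟨β, hβ, hu⟩ := exists_upper_upper_eq (H := G.res (2 * j)) g (y.vtx (2 * j + 2))
      ((y.choice_vtx (2 * j)).trans hs.symm)
    refine ⟨⟨β, ?_, hβ⟩, hu⟩
    change ResEdge.upper (G := G.res (2 * j)) (ResEdge.upper β) ∈ G.red (2 * j)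
    rw [hu]
    exact hg
  choose next hnext using step
  -- `g j` is to be `redEven j` of the preimage, and below `f₁ j` its `redOdd j`, `w j` and `b j`
  -- its vertices of index `2 * j + 1` and `2 * j`.
  let g : (j : ℕ) → {g : G.FEdge (2 * j) // g ∈ G.red (2 * j) ∧ G.sc (2 * j) g = y.vtx (2 * j)} :=
    fun j => Nat.rec ⟨f, hf, h⟩ next j
  have hg : ∀ j, upper (n := 2 * j) (upper (n := 2 * j + 1) (g (j + 1)).1) = (g j).1 :=
    fun j => hnext j (g j)
  let f₁ : (j : ℕ) → G.FEdge (2 * j + 1) := fun j => upper (n := 2 * j + 1) (g (j + 1)).1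
  have hf₁ : ∀ j, f₁ j ∈ G.red (2 * j + 1) := fun j => (g (j + 1)).2.1
  let w : (j : ℕ) → G.FVertex (2 * j + 2) := fun j => G.sc (2 * j + 1) (f₁ j)
  let b : (j : ℕ) → G.FVertex (2 * j + 1) := fun j =>
    G.rg (2 * j + 1) (G.blueEdge (2 * j + 1) (w j))
  -- The blue edge at `w (j + 1)` and the red edge `f₁ (j + 1)` have the same source, so their upper
  -- indices have the same range; for the red one this is the range of `g (j + 1)`, which is `w j`.
  have hb : ∀ j, G.rg (2 * j + 2) (G.blueEdge (2 * j + 2) (b (j + 1))) = w j := by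
    intro j
    have h1 : upper (G.blueEdge (2 * (j + 1) + 1) (w (j + 1))) =
        G.blueEdge (2 * j + 2) (b (j + 1)) :=
      upper_blue_eq (blueEdge_mem _ _) (blueEdge_mem _ _) (sc_blueEdge _ _).symm
    rw [← h1]
    exact (rg_upper_congr (e' := f₁ (j + 1)) (sc_blueEdge _ _)).trans
      (congrArg (G.rg (2 * j + 2)) (hg (j + 1)))
  obtain ⟨c, hc0, hco, hce⟩ := exists_interleave (α := fun n => G.FVertex (n + 1)) (b 0) w
    (fun j => b (j + 1))
  have hce' : ∀ j, c (2 * j) = b j := fun j => by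
    cases j with
    | zero => exact hc0
    | succ j => exact hce j
  have hc : ∀ n, G.rg (n + 1) (G.blueEdge (n + 1) (c (n + 1))) = c n := by
    intro n
    rcases Nat.even_or_odd' n with ⟨k, rfl | rfl⟩
    · rw [hco, hce']
    · rw [hco, ← hb]
      exact congrArg _ (congrArg _ (hce k))
  have hodd : ∀ j, (ofVtx c hc).redOdd j = f₁ j := fun j =>
    redEdge_eq (hf₁ j) (by rw [vtx_ofVtx, hco])
  have heven : ∀ j, (ofVtx c hc).redEven j = (g j).1 := fun j => by
    rw [redEven, hodd]
    exact hg j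
  refine ⟨ofVtx c hc, shift_eq fun j => ?_, heven 0⟩
  rw [heven]
  exact (g j).2.2.symm

theorem exists_edge_zero_eq (e : G.FEdge 0) (he : e ∈ G.blue 0) : ∃ x : G.Path, x.1 0 = e := by
  have step : ∀ n (e : {e : G.FEdge n // e ∈ G.blue n}),
      ∃ e' : {e' : G.FEdge (n + 1) // e' ∈ G.blue (n + 1)}, G.rg (n + 1) e'.1 = G.sc n e.1 := by
    intro n e
    obtain ⟨X, ⟨hX, hXB⟩, -⟩ := (G.blue_facts (n + 1)).2 (G.sc n e.1)
    obtain ⟨e', he'⟩ := (G.res (n + 1)).nonempty_of_mem _ X hX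
    exact ⟨⟨e', hXB he'⟩, (G.res (n + 1)).r_of_mem hX he'⟩
  choose next hnext using step
  let g : (n : ℕ) → {e : G.FEdge n // e ∈ G.blue n} := fun n => Nat.rec ⟨e, he⟩ next n
  exact ⟨⟨fun n => (g n).1, fun n => (g n).2, fun n => hnext n (g n)⟩, rfl⟩

end Path

theorem BlueEdge.eq_of_s_eq {e e' : G.BlueEdge} (h : G.s e.1 = G.s e'.1) : e = e' :=
  Subtype.ext (G.blue_unique (n := 0) e.2 e'.2 h)

theorem mem_natZ_iff {x : G.Path} {e : G.BlueEdge} : x ∈ G.natZ e ↔ x.vtx 0 = G.s e.1 := by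
  constructor
  · intro h
    exact congrArg (G.sc 0) h
  · intro h
    exact G.blue_unique (x.2.1 0) e.2 h

/-- The conditions on `x₀` and on `shift x` are consequences of the romb condition, since range and
source of the labelled edge are prescribed. -/
theorem mem_natW_iff {lab : G.RedLabelling} {x : G.Path} {e : G.BlueEdge} {w : G.V₀}
    {k : Fin (G.redAdj e w)} : x ∈ G.natW lab e w k ↔ x.redEven 0 = (lab e w k).1 := by
  have hR := (lab e w k).2.1
  constructor
  · rintro ⟨-, -, f₁, hf, hu⟩
    have h : x.redOdd 0 = f₁ := redEdge_eq (j := 0) hf.red_f₁ hf.source_eq.symm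
    exact (congrArg upper h).trans hu
  · intro h
    refine ⟨?_, ?_, x.redOdd 0, ⟨x.2.1 0, x.2.1 1, ?_, x.redOdd_mem 0, (x.2.2 0).symm, ?_, ?_,
      (x.sc_redOdd 0).symm⟩, h⟩
    · refine (x.rg_redEven 0).symm.trans ?_
      rw [h]
      exact G.r_of_mem_R hR
    · rw [mem_natZ_iff]
      refine (Path.vtx_shift x 0).trans ?_
      rw [h]
      exact (lab e w k).2.2
    · rw [← h]
      exact x.redEven_mem 0
    · rw [← h]
      rfl
    · rw [← h]
      exact (x.rg_redEven 0).symm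

end GenFiniteShiftGraph

/-! ### Topology of the path space and the natural structure -/

namespace GenFiniteShiftGraph

open BipSepGraph

variable {G : GenFiniteShiftGraph.{u}}

namespace Path

theorem isLocallyConstant_edge (n : ℕ) : IsLocallyConstant fun x : G.Path => x.1 n := by
  let : ∀ n, TopologicalSpace (G.FEdge n) := fun _ => ⊥
  have : ∀ n, DiscreteTopology (G.FEdge n) := fun _ => ⟨rfl⟩
  rw [IsLocallyConstant.iff_continuous]
  exact (continuous_apply n).comp (continuous_induced_dom (f := fun x : G.Path => x.1))

theorem isLocallyConstant_vtx (n : ℕ) : IsLocallyConstant fun x : G.Path => x.vtx n :=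
  (isLocallyConstant_edge n).comp (G.sc n)

theorem isLocallyConstant_redEven (j : ℕ) : IsLocallyConstant fun x : G.Path => x.redEven j :=
  (isLocallyConstant_vtx (2 * j + 1)).comp fun w => upper (G.redEdge j w)

theorem continuous_of_isLocallyConstant_vtx {Y : Type v} [TopologicalSpace Y] {f : Y → G.Path}
    (h : ∀ n, IsLocallyConstant fun y => (f y).vtx n) : Continuous f := by
  let : ∀ n, TopologicalSpace (G.FEdge n) := fun _ => ⊥
  have : ∀ n, DiscreteTopology (G.FEdge n) := fun _ => ⟨rfl⟩
  refine continuous_induced_rng.2 (continuous_pi fun n => ?_)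
  refine IsLocallyConstant.continuous ?_
  have := (h n).comp (G.blueEdge n)
  convert this using 2 with y
  exact (f y).edge_eq n

theorem continuous_shift : Continuous G.shift := by
  have heven : ∀ j, IsLocallyConstant fun x => (G.shift x).vtx (2 * j) := fun j => by
    have := (isLocallyConstant_redEven (G := G) j).comp (G.sc (2 * j))
    convert this using 2 with x
    exact vtx_shift x j
  refine continuous_of_isLocallyConstant_vtx fun n => ?_
  rcases Nat.even_or_odd' n with ⟨k, rfl | rfl⟩
  · exact heven k
  · have := (heven (k + 1)).comp fun w => G.rg (2 * k + 2) (G.blueEdge (2 * k + 2) w)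
    convert this using 2 with x
    exact (rg_blueEdge_vtx (G.shift x) (2 * k + 1)).symm

-- Each condition defining a path involves at most two neighbouring coordinates, so the paths form a
-- closed subset of a product of finite discrete spaces.
open Topology in
theorem compact_totallyDisconnected_metrizable :
    CompactSpace G.Path ∧ TotallyDisconnectedSpace G.Path ∧
      TopologicalSpace.MetrizableSpace G.Path := by
  let : ∀ n, TopologicalSpace (G.FEdge n) := fun _ => ⊥
  have : ∀ n, DiscreteTopology (G.FEdge n) := fun _ => ⟨rfl⟩
  have : ∀ n, Finite (G.FEdge n) := fun n => (G.res n).finite_Edge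
  have hemb : IsEmbedding fun x : G.Path => x.1 := ⟨⟨rfl⟩, Subtype.val_injective⟩
  have hclosed : IsClosed (range fun x : G.Path => x.1) := by
    have : (range fun x : G.Path => x.1) =
        (⋂ n, {e : (n : ℕ) → G.FEdge n | e n ∈ G.blue n}) ∩
          ⋂ n, {e : (n : ℕ) → G.FEdge n | G.rg (n + 1) (e (n + 1)) = G.sc n (e n)} := by
      ext e
      constructor
      · rintro ⟨x, rfl⟩
        exact ⟨mem_iInter.2 x.2.1, mem_iInter.2 x.2.2⟩
      · rintro ⟨h1, h2⟩
        exact ⟨⟨e, mem_iInter.1 h1, mem_iInter.1 h2⟩, rfl⟩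
    rw [this]
    refine (isClosed_iInter fun n => ?_).inter (isClosed_iInter fun n => ?_)
    · exact (isClosed_discrete (G.blue n)).preimage (continuous_apply n)
    · exact (isClosed_discrete
        {p : G.FEdge (n + 1) × G.FEdge n | G.rg (n + 1) p.1 = G.sc n p.2}).preimage
        ((continuous_apply (n + 1)).prodMk (continuous_apply n))
  refine ⟨(IsClosedEmbedding.mk hemb hclosed).compactSpace, ?_, hemb.metrizableSpace⟩
  refine (hemb.isTotallyDisconnected_range).1 ?_
  exact isTotallyDisconnected_of_totallyDisconnectedSpace _

end Path

/-- A continuous map on a compact Hausdorff space that is injective on open compact sets covering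
the space, with open images, is a local homeomorphism. -/
theorem isLocalHomeomorph_of_cover {X : Type v} [TopologicalSpace X] [T2Space X]
    {f : X → X} (hf : Continuous f)
    (h : ∀ x, ∃ V : Set X, x ∈ V ∧ IsOpen V ∧ IsCompact V ∧ InjOn f V ∧ IsOpen (f '' V)) :
    IsLocalHomeomorph f := by
  rw [isLocalHomeomorph_iff_isOpenEmbedding_restrict]
  intro x
  obtain ⟨V, hx, hVo, hVc, hinj, hopen⟩ := h x
  refine ⟨V, hVo.mem_nhds hx, ?_⟩
  have := isCompact_iff_compactSpace.1 hVc
  have hc : Topology.IsClosedEmbedding (V.domRestrict f) :=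
    (hf.comp continuous_subtype_val).isClosedEmbedding (injOn_iff_injective.1 hinj)
  refine ⟨hc.isEmbedding, ?_⟩
  rwa [range_domRestrict]

variable (lab : G.RedLabelling)

theorem exists_lab_eq {f : G.FEdge 0} (hf : f ∈ G.red 0) :
    ∃ (e : G.BlueEdge) (k : Fin (G.redAdj e (G.rg 0 f))), (lab e (G.rg 0 f) k).1 = f := by
  let e : G.BlueEdge := ⟨G.blueEdge 0 (G.sc 0 f), blueEdge_mem 0 _⟩
  let g : G.RedFrom e (G.rg 0 f) := ⟨f, hf, (sc_blueEdge 0 (G.sc 0 f)).symm⟩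
  exact ⟨e, (lab e _).symm g, by rw [Equiv.apply_symm_apply]⟩

theorem rg_lab (e : G.BlueEdge) (w : G.V₀) (k : Fin (G.redAdj e w)) :
    G.rg 0 (lab e w k).1 = w :=
  G.r_of_mem_R (lab e w k).2.1

theorem lab_mem_red (e : G.BlueEdge) (w : G.V₀) (k : Fin (G.redAdj e w)) :
    (lab e w k).1 ∈ G.red 0 := by
  have h : (lab e w k).1 ∈ G.R (G.r (lab e w k).1) := by
    rw [show G.r (lab e w k).1 = w from rg_lab lab e w k]
    exact (lab e w k).2.1
  exact h

theorem lab_injective {w : G.V₀} {q q' : Σ e, Fin (G.redAdj e w)}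
    (h : (lab q.1 w q.2).1 = (lab q'.1 w q'.2).1) : q = q' := by
  obtain ⟨e, k⟩ := q
  obtain ⟨e', k'⟩ := q'
  obtain rfl : e = e' := BlueEdge.eq_of_s_eq
    ((lab e w k).2.2.symm.trans ((congrArg G.s h).trans (lab e' w k').2.2))
  have : k = k' := (lab e w).injective (Subtype.ext h)
  rw [this]

theorem isOpen_natZ (e : G.BlueEdge) : IsOpen (G.natZ e) :=
  (Path.isLocallyConstant_edge 0).isOpen_fiber e.1

theorem isClosed_natZ (e : G.BlueEdge) : IsClosed (G.natZ e) :=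
  (Path.isLocallyConstant_edge 0).isClosed_fiber e.1

theorem natW_eq (e : G.BlueEdge) (w : G.V₀) (k : Fin (G.redAdj e w)) :
    G.natW lab e w k = {x | x.redEven 0 = (lab e w k).1} :=
  ext fun _ => mem_natW_iff

theorem isOpen_natW (e : G.BlueEdge) (w : G.V₀) (k : Fin (G.redAdj e w)) :
    IsOpen (G.natW lab e w k) := by
  rw [natW_eq]
  exact (Path.isLocallyConstant_redEven 0).isOpen_fiber _

theorem isClosed_natW (e : G.BlueEdge) (w : G.V₀) (k : Fin (G.redAdj e w)) :
    IsClosed (G.natW lab e w k) := by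
  rw [natW_eq]
  exact (Path.isLocallyConstant_redEven 0).isClosed_fiber _

theorem natZ_nonempty (e : G.BlueEdge) : (G.natZ e).Nonempty :=
  Path.exists_edge_zero_eq e.1 e.2

theorem injOn_shift_natW (e : G.BlueEdge) (w : G.V₀) (k : Fin (G.redAdj e w)) :
    InjOn G.shift (G.natW lab e w k) := fun _ hx _ hy h =>
  Path.eq_of_shift_eq h ((mem_natW_iff.1 hx).trans (mem_natW_iff.1 hy).symm)

theorem image_shift_natW (e : G.BlueEdge) (w : G.V₀) (k : Fin (G.redAdj e w)) :
    G.shift '' G.natW lab e w k = G.natZ e := by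
  ext y
  constructor
  · rintro ⟨x, hx, rfl⟩
    exact hx.2.1
  · intro hy
    obtain ⟨x, hx, h⟩ := y.exists_shift_eq (lab e w k).1 (lab_mem_red lab e w k)
      ((lab e w k).2.2.trans (mem_natZ_iff.1 hy).symm)
    exact ⟨x, mem_natW_iff.2 h, hx⟩

theorem surjective_shift : Function.Surjective G.shift := by
  intro y
  have hw : y.vtx 0 ∈ ⋃ w, G.s '' G.R w := by
    rw [G.iUnion_s_R]
    trivial
  obtain ⟨w, f, hf, hs⟩ := mem_iUnion.1 hw
  have hf' : f ∈ G.R (G.r f) := by rwa [G.r_of_mem_R hf]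
  obtain ⟨x, hx, -⟩ := y.exists_shift_eq f hf' hs
  exact ⟨x, hx⟩

theorem exists_mem_natW (x : G.Path) :
    ∃ (e : G.BlueEdge) (k : Fin (G.redAdj e (G.rg 0 (x.1 0)))), x ∈ G.natW lab e _ k := by
  obtain ⟨e, k, h⟩ := exists_lab_eq lab (x.redEven_mem 0)
  have hr : G.rg 0 (x.redEven 0) = G.rg 0 (x.1 0) := x.rg_redEven 0
  -- The type of `k` mentions the range that is rewritten.
  revert k
  rw [hr]
  exact fun k hk => ⟨e, k, mem_natW_iff.2 hk.symm⟩

theorem isLHomeo_shift : IsLHomeo G.shift := by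
  obtain ⟨h1, h2, h3⟩ := Path.compact_totallyDisconnected_metrizable (G := G)
  refine ⟨h1, h2, h3, surjective_shift, ?_⟩
  -- Any labelling will do; it only serves to name the sets of the cover.
  obtain ⟨lab⟩ : Nonempty G.RedLabelling := by
    have := G.finite_Edge
    have : ∀ (e : G.BlueEdge) (w : G.V₀), Finite (G.RedFrom e w) := fun e w =>
      Subtype.finite
    exact ⟨fun e w => (Finite.equivFin (G.RedFrom e w)).symm⟩
  refine isLocalHomeomorph_of_cover Path.continuous_shift fun x => ?_
  obtain ⟨e, k, hx⟩ := exists_mem_natW lab x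
  refine ⟨_, hx, isOpen_natW lab _ _ k, (isClosed_natW lab _ _ k).isCompact,
    injOn_shift_natW lab _ _ k, ?_⟩
  exact (image_shift_natW lab _ _ k).symm ▸ isOpen_natZ e

theorem isStructure_shift : G.IsStructure G.shift G.natZ (G.natW lab) := by
  have := (Path.compact_totallyDisconnected_metrizable (G := G)).1
  refine ⟨?_, ?_, natZ_nonempty, fun e => (isClosed_natZ e).isCompact, isOpen_natZ, ?_, ?_,
    fun e w k => (isClosed_natW lab e w k).isCompact, isOpen_natW lab, ?_, ?_, ?_,
    injOn_shift_natW lab, image_shift_natW lab⟩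
  · have := G.finite_Edge
    exact Subtype.finite
  · intro w
    obtain ⟨e, he⟩ := G.nonempty_of_mem w _ (G.B_mem w)
    have hr := G.r_of_mem_B he
    exact ⟨⟨e, by rwa [hr]⟩, hr⟩
  · intro e e' hne
    refine disjoint_left.2 fun x hx hx' => hne (Subtype.ext ?_)
    exact (show x.1 0 = e.1 from hx).symm.trans hx'
  -- `natW` is non-empty because its image `natZ e` is.
  · intro e w k
    have h := natZ_nonempty e
    rw [← image_shift_natW lab e w k] at h
    exact h.of_image
  · exact eq_univ_of_forall fun x => mem_iUnion.2 ⟨⟨x.1 0, x.2.1 0⟩, rfl⟩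
  · intro w
    ext x
    simp only [mem_iUnion]
    constructor
    · rintro ⟨e, k, hx⟩
      exact ⟨⟨x.1 0, x.2.1 0⟩, hx.1, rfl⟩
    · rintro ⟨e, rfl, hx⟩
      obtain ⟨e', k, h⟩ := exists_mem_natW lab x
      have hx' : x.1 0 = e.1 := hx
      revert k
      rw [hx']
      exact fun k hk => ⟨e', k, hk⟩
  · intro w q q' hne
    refine disjoint_left.2 fun x hx hx' => hne ?_
    exact lab_injective lab ((mem_natW_iff.1 hx).symm.trans (mem_natW_iff.1 hx'))

end GenFiniteShiftGraph

/-! ### Actions of separated graphs and their resolutions -/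

namespace BipSepGraph

/-- A dynamical system over a separated graph: the spaces `A` and `D` are decomposed according to
the vertices in `V₀` and in `V₁`, every edge `e` acts as a homeomorphism from an open subset of
`A` onto the part of `D` at `s(e)`, and for every set of the partition `C w` the domains of its
edges form a decomposition of the part of `A` at `w`.  The relation `act e` is the graph of this
homeomorphism. -/
structure DynSystem (H : BipSepGraph.{u}) (A D : Type v) [TopologicalSpace A]
    [TopologicalSpace D] where
  vert₀ : A → H.V₀
  vert₁ : D → H.V₁
  act : H.Edge → A → D → Prop
  vert₁_eq : ∀ {e a d}, act e a d → vert₁ d = H.s e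
  existsUnique_edge : ∀ a, ∀ X ∈ H.C (vert₀ a), ∃! e, e ∈ X ∧ ∃ d, act e a d
  vert₀_eq : ∀ {e a d}, act e a d → vert₀ a = H.r e
  right_unique : ∀ {e a d d'}, act e a d → act e a d' → d = d'
  existsUnique_left : ∀ {e d}, vert₁ d = H.s e → ∃! a, act e a d
  isLocallyConstant_vert₀ : IsLocallyConstant vert₀
  isLocallyConstant_vert₁ : IsLocallyConstant vert₁
  isOpen_image : ∀ e (U : Set A), IsOpen U → IsOpen {d | ∃ a ∈ U, act e a d}
  isOpen_preimage : ∀ e (U : Set D), IsOpen U → IsOpen {a | ∃ d ∈ U, act e a d}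

namespace DynSystem

variable {H : BipSepGraph.{u}} {A D : Type v} [TopologicalSpace A] [TopologicalSpace D]
  (S : H.DynSystem A D)

/-- The choice of the edges that act on a point. -/
noncomputable def choice (a : A) : H.Choice :=
  ⟨S.vert₀ a, fun X => ⟨(S.existsUnique_edge a X.1 X.2).choose,
    (S.existsUnique_edge a X.1 X.2).choose_spec.1.1⟩⟩

theorem exists_act_choice (a : A) {X : Set H.Edge} (hX : X ∈ H.C (S.vert₀ a)) :
    ∃ d, S.act ((S.choice a).2 ⟨X, hX⟩ : H.Edge) a d :=
  (S.existsUnique_edge a X hX).choose_spec.1.2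

theorem choice_eq_of_act {e : H.Edge} {a : A} {d : D} (h : S.act e a d) {X : Set H.Edge}
    (hX : X ∈ H.C (S.vert₀ a)) (he : e ∈ X) : ((S.choice a).2 ⟨X, hX⟩ : H.Edge) = e :=
  (S.existsUnique_edge a X hX).unique (S.existsUnique_edge a X hX).choose_spec.1 ⟨he, d, h⟩

theorem exists_act_upper {α : H.ResEdge} {a : A} (h : S.choice a = α.1) :
    ∃ d, S.act α.upper a d := by
  obtain ⟨c, X⟩ := α
  obtain rfl : S.choice a = c := h
  exact S.exists_act_choice a X.2

theorem choice_eq_iff {a : A} {c : H.Choice} :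
    S.choice a = c ↔ S.vert₀ a = c.1 ∧ ∀ X : ↥(H.C c.1), ∃ d, S.act (c.2 X : H.Edge) a d := by
  constructor
  · rintro rfl
    exact ⟨rfl, fun X => S.exists_act_choice a X.2⟩
  · rintro ⟨h0, h⟩
    obtain ⟨w, g⟩ := c
    obtain rfl : S.vert₀ a = w := h0
    unfold choice
    congr 1
    funext X
    obtain ⟨d, hd⟩ := h X
    exact Subtype.ext (S.choice_eq_of_act hd X.2 (g X).2)

/-- The set is a finite intersection of domains of edges with the part at a vertex. This makes the
vertex map of the resolved system locally constant. -/
theorem isOpen_choice_eq (c : H.Choice) : IsOpen {a | S.choice a = c} := by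
  have := H.finite_Edge
  have : {a | S.choice a = c} = {a | S.vert₀ a = c.1} ∩
      ⋂ X : ↥(H.C c.1), {a | ∃ d ∈ univ, S.act (c.2 X : H.Edge) a d} := by
    ext a
    simp [S.choice_eq_iff]
  rw [this]
  exact (S.isLocallyConstant_vert₀.isOpen_fiber _).inter
    (isOpen_iInter_of_finite fun X => S.isOpen_preimage _ _ isOpen_univ)

/-- The system over the one-step resolution, with inverted action. -/
noncomputable def resolution : H.resolution.DynSystem D A where
  vert₀ := S.vert₁
  vert₁ := S.choice
  -- An edge acts as the inverse of its upper index, restricted to the points whose choice is the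
  -- source of the edge.
  act := fun α d a => S.act (ResEdge.upper α) a d ∧ S.choice a = H.resolution.s α
  vert₁_eq := fun h => h.2
  vert₀_eq := fun h => S.vert₁_eq h.1
  existsUnique_edge := by
    rintro d X ⟨y, hy, rfl⟩
    obtain ⟨a, ha, huniq⟩ := S.existsUnique_left (e := y) (d := d) hy.symm
    obtain ⟨Z, hZ, hyZ⟩ := H.exists_mem y
    rw [← S.vert₀_eq ha] at hZ
    have hup := S.choice_eq_of_act ha hZ hyZ
    -- The only candidate is the edge with upper index `y` whose source is the choice of the
    -- preimage `a` of `d` under `y`.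
    refine ⟨(⟨S.choice a, ⟨Z, hZ⟩⟩ : H.ResEdge), ⟨hup, a, ?_, rfl⟩, ?_⟩
    · change S.act ((S.choice a).2 ⟨Z, hZ⟩ : H.Edge) a d
      rwa [hup]
    · rintro α ⟨hα : ResEdge.upper α = y, a', ha', hc⟩
      rw [hα] at ha'
      obtain rfl := huniq a' ha'
      exact ResEdge.eq_of_source_of_upper hc.symm (hα.trans hup.symm)
  right_unique := fun h h' =>
    (S.existsUnique_left (S.vert₁_eq h.1)).unique h.1 h'.1
  existsUnique_left := by
    intro α a h
    obtain ⟨d, hd⟩ := S.exists_act_upper (α := α) h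
    exact ⟨d, ⟨hd, h⟩, fun d' h' => S.right_unique h'.1 hd⟩
  isLocallyConstant_vert₀ := S.isLocallyConstant_vert₁
  isLocallyConstant_vert₁ := IsLocallyConstant.iff_isOpen_fiber.2 S.isOpen_choice_eq
  isOpen_image := by
    intro α U hU
    have : {a | ∃ d ∈ U, S.act (ResEdge.upper α) a d ∧ S.choice a = H.resolution.s α} =
        {a | ∃ d ∈ U, S.act (ResEdge.upper α) a d} ∩ {a | S.choice a = H.resolution.s α} := by
      ext a
      constructor
      · rintro ⟨d, hd, h, hc⟩
        exact ⟨⟨d, hd, h⟩, hc⟩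
      · rintro ⟨⟨d, hd, h⟩, hc⟩
        exact ⟨d, hd, h, hc⟩
    rw [this]
    exact (S.isOpen_preimage _ U hU).inter (S.isOpen_choice_eq _)
  isOpen_preimage := by
    intro α U hU
    have : {d | ∃ a ∈ U, S.act (ResEdge.upper α) a d ∧ S.choice a = H.resolution.s α} =
        {d | ∃ a ∈ U ∩ {a | S.choice a = H.resolution.s α}, S.act (ResEdge.upper α) a d} := by
      ext d
      constructor
      · rintro ⟨a, ha, h, hc⟩
        exact ⟨a, ⟨ha, hc⟩, h⟩
      · rintro ⟨a, ⟨ha, hc⟩, h⟩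
        exact ⟨a, ha, h, hc⟩
    rw [this]
    exact S.isOpen_image _ _ (hU.inter (S.isOpen_choice_eq _))

end DynSystem

end BipSepGraph

/-! ### From a structure to an action of the graph -/

namespace GenFiniteShiftGraph

open BipSepGraph

variable {G : GenFiniteShiftGraph.{u}} {Y : Type v} [TopologicalSpace Y]

/-- A dynamical system over `(E, C)` on two copies of a space `Y` for which the blue edges act by
restrictions of the identity and the red edges by restrictions of `ρ`. -/
structure ShiftSystem (G : GenFiniteShiftGraph.{u}) (ρ : Y → Y) extends
    DynSystem G.toBipSepGraph Y Y where
  eq_of_blue : ∀ {e : G.Edge} {a d}, e ∈ G.B (G.r e) → act e a d → a = d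
  eq_of_red : ∀ {e : G.Edge} {a d}, e ∈ G.R (G.r e) → act e a d → ρ a = d

section Structure

variable {ρ : Y → Y} {Z : G.BlueEdge → Set Y}
  {W : (e : G.BlueEdge) → (w : G.V₀) → Fin (G.redAdj e w) → Set Y}

/-- The system of an `(E, C)`-structure. -/
theorem exists_shiftSystem (lab : G.RedLabelling) (hρ : IsLocalHomeomorph ρ)
    (h : G.IsStructure ρ Z W) :
    ∃ S : G.ShiftSystem ρ, (∀ e y, y ∈ Z e → S.vert₁ y = G.s e.1) ∧
      (∀ e y, y ∈ Z e → S.act e.1 y y) ∧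
      (∀ e w k y, y ∈ W e w k → S.act (lab e w k).1 y (ρ y)) := by
  have hcover : ∀ y, ∃ e, y ∈ Z e := fun y => mem_iUnion.1 (h.iUnion_Z.symm ▸ mem_univ y)
  choose zone hzone using hcover
  have hZ : ∀ {e y}, y ∈ Z e → zone y = e := fun {e y} hy => by
    by_contra hne
    exact disjoint_left.1 (h.Z_disjoint hne) (hzone y) hy
  have hlc : IsLocallyConstant zone := by
    refine IsLocallyConstant.iff_isOpen_fiber.2 fun e => ?_
    convert h.Z_open e using 1
    ext y
    exact ⟨fun hy => (show zone y = e from hy) ▸ hzone y, hZ⟩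
  have hW : ∀ {e w k y}, y ∈ W e w k → G.r (zone y).1 = w := fun {e w k y} hy => by
    have : y ∈ ⋃ γ, ⋃ (_ : G.r γ.1 = w), Z γ := by
      rw [← h.iUnion_V w]
      exact mem_iUnion.2 ⟨e, mem_iUnion.2 ⟨k, hy⟩⟩
    simp only [mem_iUnion] at this
    obtain ⟨γ, hγ, hy'⟩ := this
    rw [hZ hy', hγ]
  have hWex : ∀ y, ∃ e k, y ∈ W e (G.r (zone y).1) k := fun y => by
    have : y ∈ ⋃ e, ⋃ k, W e (G.r (zone y).1) k := by
      rw [h.iUnion_V]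
      exact mem_iUnion.2 ⟨zone y, mem_iUnion.2 ⟨rfl, hzone y⟩⟩
    simpa only [mem_iUnion] using this
  have hWρ : ∀ {e w k y}, y ∈ W e w k → zone (ρ y) = e := fun {e w k y} hy =>
    hZ ((h.image_eq e w k).subset (mem_image_of_mem ρ hy))
  have hlabR : ∀ e w k, (lab e w k).1 ∈ G.R (G.r (lab e w k).1) := lab_mem_red lab
  have hBR : ∀ {e : G.Edge}, e ∈ G.B (G.r e) → e ∉ G.R (G.r e) := fun {e} hb hr =>
    disjoint_left.1 (G.disjoint_B_R _) hb hr
  -- At most one disjunct can hold for a given edge, as blue and red edges are disjoint. The labels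
  -- are recovered from the edge, which gives `act_blue` and `act_red`.
  let act : G.Edge → Y → Y → Prop := fun f a d =>
    (∃ e : G.BlueEdge, f = e.1 ∧ a = d ∧ a ∈ Z e) ∨
      ∃ e w k, f = (lab e w k).1 ∧ ρ a = d ∧ a ∈ W e w k
  have act_blue : ∀ {e : G.BlueEdge} {a d}, act e.1 a d → a = d ∧ a ∈ Z e := by
    rintro e a d (⟨e', he, had, ha⟩ | ⟨e', w, k, he, -⟩)
    · obtain rfl : e = e' := Subtype.ext he
      exact ⟨had, ha⟩
    · exact absurd (he ▸ hlabR e' w k) (hBR e.2)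
  have act_red : ∀ {e w k a d}, act (lab e w k).1 a d → ρ a = d ∧ a ∈ W e w k := by
    rintro e w k a d (⟨e', he, -⟩ | ⟨e', w', k', he, had, ha⟩)
    · exact absurd (hlabR e w k) (hBR (he ▸ e'.2))
    · have hw : w = w' := by
        rw [← rg_lab lab e w k, ← rg_lab lab e' w' k', he]
      subst hw
      obtain ⟨rfl, hk⟩ := Sigma.mk.inj_iff.1
        (lab_injective lab (q := ⟨e, k⟩) (q' := ⟨e', k'⟩) he)
      obtain rfl := eq_of_heq hk
      exact ⟨had, ha⟩
  have cases_edge : ∀ f : G.Edge,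
      (∃ e : G.BlueEdge, f = e.1) ∨ ∃ e w k, f = (lab e w k).1 := by
    intro f
    rcases blue_or_red 0 f with hf | hf
    · exact Or.inl ⟨⟨f, hf⟩, rfl⟩
    · obtain ⟨e, k, hk⟩ := exists_lab_eq lab hf
      exact Or.inr ⟨e, _, k, hk.symm⟩
  have hopen : IsOpenMap ρ := hρ.isOpenMap
  refine ⟨{
    vert₀ := fun y => G.r (zone y).1
    vert₁ := fun y => G.s (zone y).1
    act := act
    vert₁_eq := ?_
    existsUnique_edge := ?_
    vert₀_eq := ?_
    right_unique := ?_
    existsUnique_left := ?_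
    isLocallyConstant_vert₀ := hlc.comp fun e => G.r e.1
    isLocallyConstant_vert₁ := hlc.comp fun e => G.s e.1
    isOpen_image := ?_
    isOpen_preimage := ?_
    eq_of_blue := fun {e a d} he hact => (act_blue (e := ⟨e, he⟩) hact).1
    eq_of_red := ?_ }, fun e y hy => congrArg (fun e : G.BlueEdge => G.s e.1) (hZ hy),
    fun e y hy => Or.inl ⟨e, rfl, rfl, hy⟩, fun e w k y hy => Or.inr ⟨e, w, k, rfl, rfl, hy⟩⟩
  · rintro f a d (⟨e, rfl, rfl, ha⟩ | ⟨e, w, k, rfl, rfl, ha⟩)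
    · rw [hZ ha]
    · rw [hWρ ha]
      exact (lab e w k).2.2.symm
  · intro a X hX
    rw [G.C_eq] at hX
    rcases hX with rfl | rfl
    · refine ⟨(zone a).1, ⟨(zone a).2, a, Or.inl ⟨zone a, rfl, rfl, hzone a⟩⟩, ?_⟩
      rintro f ⟨hf, d, hact⟩
      have hf' : f ∈ G.B (G.r f) := by rwa [G.r_of_mem_B hf]
      rw [hZ (act_blue (e := ⟨f, hf'⟩) hact).2]
    · obtain ⟨e, k, ha⟩ := hWex a
      refine ⟨(lab e _ k).1, ⟨(lab e _ k).2.1, _, Or.inr ⟨e, _, k, rfl, rfl, ha⟩⟩, ?_⟩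
      rintro f ⟨hf, d, hact⟩
      have hf' : f ∈ G.red 0 := show f ∈ G.R (G.r f) by rwa [G.r_of_mem_R hf]
      obtain ⟨e', w', k', rfl⟩ : ∃ e' w' k', f = (lab e' w' k').1 :=
        let ⟨e', k', h'⟩ := exists_lab_eq lab hf'
        ⟨e', _, k', h'.symm⟩
      obtain rfl : w' = G.r (zone a).1 := (rg_lab lab e' w' k').symm.trans (G.r_of_mem_R hf)
      have hd := h.V_disjoint (G.r (zone a).1)
      by_contra hne
      refine disjoint_left.1 (@hd ⟨e', k'⟩ ⟨e, k⟩ fun hq => hne ?_) (act_red hact).2 ha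
      obtain ⟨rfl, hk⟩ := Sigma.mk.inj_iff.1 hq
      rw [eq_of_heq hk]
  · rintro f a d (⟨e, rfl, rfl, ha⟩ | ⟨e, w, k, rfl, rfl, ha⟩)
    · rw [hZ ha]
    · rw [hW ha]
      exact (rg_lab lab e w k).symm
  · rintro f a d d' hd hd'
    rcases cases_edge f with ⟨e, rfl⟩ | ⟨e, w, k, rfl⟩
    · exact (act_blue hd).1.symm.trans (act_blue hd').1
    · exact (act_red hd).1.symm.trans (act_red hd').1
  -- Blue edges have distinct sources, so the vertex of `d` tells in which `Z e` it lies. For a red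
  -- edge the preimage then comes from `ρ` mapping `W e w k` bijectively onto `Z e`.
  · intro f d hd
    rcases cases_edge f with ⟨e, rfl⟩ | ⟨e, w, k, rfl⟩
    · have hd' : d ∈ Z e := BlueEdge.eq_of_s_eq hd ▸ hzone d
      exact ⟨d, Or.inl ⟨e, rfl, rfl, hd'⟩, fun a ha => (act_blue ha).1⟩
    · have hd' : d ∈ Z e := BlueEdge.eq_of_s_eq (hd.trans (lab e w k).2.2) ▸ hzone d
      rw [← h.image_eq e w k] at hd'
      obtain ⟨a, ha, rfl⟩ := hd'
      exact ⟨a, Or.inr ⟨e, w, k, rfl, rfl, ha⟩, fun a' ha' =>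
        h.injOn e w k (act_red ha').2 ha (act_red ha').1⟩
  · intro f U hU
    rcases cases_edge f with ⟨e, rfl⟩ | ⟨e, w, k, rfl⟩
    · convert hU.inter (h.Z_open e) using 1
      ext d
      constructor
      · rintro ⟨a, ha, hact⟩
        obtain ⟨rfl, hZa⟩ := act_blue hact
        exact ⟨ha, hZa⟩
      · rintro ⟨hd, hZd⟩
        exact ⟨d, hd, Or.inl ⟨e, rfl, rfl, hZd⟩⟩
    · convert hopen _ (hU.inter (h.V_open e w k)) using 1
      ext d
      constructor
      · rintro ⟨a, ha, hact⟩
        exact ⟨a, ⟨ha, (act_red hact).2⟩, (act_red hact).1⟩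
      · rintro ⟨a, ⟨ha, hWa⟩, rfl⟩
        exact ⟨a, ha, Or.inr ⟨e, w, k, rfl, rfl, hWa⟩⟩
  · intro f U hU
    rcases cases_edge f with ⟨e, rfl⟩ | ⟨e, w, k, rfl⟩
    · convert hU.inter (h.Z_open e) using 1
      ext d
      constructor
      · rintro ⟨a, ha, hact⟩
        obtain ⟨rfl, hZa⟩ := act_blue hact
        exact ⟨ha, hZa⟩
      · rintro ⟨hd, hZd⟩
        exact ⟨d, hd, Or.inl ⟨e, rfl, rfl, hZd⟩⟩
    · convert (hU.preimage hρ.continuous).inter (h.V_open e w k) using 1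
      ext a
      constructor
      · rintro ⟨d, hd, hact⟩
        obtain ⟨rfl, hWa⟩ := act_red hact
        exact ⟨hd, hWa⟩
      · rintro ⟨ha, hWa⟩
        exact ⟨ρ a, ha, Or.inr ⟨e, w, k, rfl, rfl, hWa⟩⟩
  · intro f a d hf hact
    obtain ⟨e, k, hk⟩ := exists_lab_eq lab (f := f) hf
    rw [← hk] at hact
    exact (act_red hact).1

end Structure

/-! ### The coding map and its uniqueness -/

namespace ShiftSystem

variable {ρ : Y → Y} (S : G.ShiftSystem ρ)

/-- The system over the `n`-step resolution. -/
noncomputable def res : (n : ℕ) → (G.res n).DynSystem Y Y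
  | 0 => S.toDynSystem
  | n + 1 => (res n).resolution

theorem act_res_succ {n : ℕ} {e : G.FEdge (n + 1)} {a d : Y} :
    (S.res (n + 1)).act e a d ↔
      (S.res n).act (upper e) d a ∧ (S.res (n + 1)).vert₁ d = G.sc (n + 1) e :=
  Iff.rfl

theorem eq_of_act_blue {n : ℕ} {e : G.FEdge n} (he : e ∈ G.blue n) {a d : Y}
    (h : (S.res n).act e a d) : a = d := by
  induction n generalizing a d with
  | zero => exact S.eq_of_blue he h
  | succ n ih => exact (ih (blue_upper.2 he) (S.act_res_succ.1 h).1).symm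

theorem eq_of_act_red_even {j : ℕ} {e : G.FEdge (2 * j)} (he : e ∈ G.red (2 * j)) {a d : Y}
    (h : (S.res (2 * j)).act e a d) : ρ a = d := by
  induction j with
  | zero => exact S.eq_of_red he h
  | succ j ih => exact ih (red_upper.2 (red_upper.2 he)) (S.act_res_succ.1 (S.act_res_succ.1 h).1).1

theorem eq_of_act_red_odd {j : ℕ} {e : G.FEdge (2 * j + 1)} (he : e ∈ G.red (2 * j + 1)) {a d : Y}
    (h : (S.res (2 * j + 1)).act e a d) : ρ d = a :=
  S.eq_of_act_red_even (red_upper.2 he) (S.act_res_succ.1 h).1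

/-- The blue edge in question acts as the identity at `y`, so its range is the vertex of `y` in `V₀`
of layer `n + 1`, which is its vertex in `V₁` of layer `n`. -/
theorem vert_compatible (y : Y) (n : ℕ) :
    G.rg (n + 1) (G.blueEdge (n + 1) ((S.res (n + 1)).vert₁ y)) = (S.res n).vert₁ y := by
  obtain ⟨d, hd, -⟩ := (S.res (n + 1)).existsUnique_left
    (sc_blueEdge (n + 1) ((S.res (n + 1)).vert₁ y)).symm
  obtain rfl := S.eq_of_act_blue (blueEdge_mem _ _) hd
  exact ((S.res (n + 1)).vert₀_eq hd).symm

theorem act_redEdge (y : Y) (j : ℕ) :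
    (S.res (2 * j + 1)).act (G.redEdge j ((S.res (2 * j + 1)).vert₁ y)) (ρ y) y := by
  obtain ⟨d, hd, -⟩ := (S.res (2 * j + 1)).existsUnique_left
    (sc_redEdge j ((S.res (2 * j + 1)).vert₁ y)).symm
  obtain rfl := S.eq_of_act_red_odd (redEdge_mem j _) hd
  exact hd

/-- The path of the vertices that carry a point. -/
noncomputable def toPath (y : Y) : G.Path :=
  Path.ofVtx (fun n => (S.res n).vert₁ y) (S.vert_compatible y)

theorem vtx_toPath (y : Y) (n : ℕ) : (S.toPath y).vtx n = (S.res n).vert₁ y :=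
  Path.vtx_ofVtx _ _ n

theorem act_redEven_toPath (y : Y) (j : ℕ) :
    (S.res (2 * j)).act ((S.toPath y).redEven j) y (ρ y) := by
  have h := (S.act_res_succ.1 (S.act_redEdge y j)).1
  rw [Path.redEven, Path.redOdd, vtx_toPath]
  exact h

theorem continuous_toPath : Continuous S.toPath := by
  refine Path.continuous_of_isLocallyConstant_vtx fun n => ?_
  simp only [vtx_toPath]
  exact (S.res n).isLocallyConstant_vert₁

/-- The edge `redEven j` of the coding path carries `y` to `ρ y`, so its source is the vertex of `ρ
y`. -/
theorem shift_toPath (y : Y) : G.shift (S.toPath y) = S.toPath (ρ y) := by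
  refine Path.shift_eq fun j => ?_
  rw [vtx_toPath]
  exact (S.res (2 * j)).vert₁_eq (S.act_redEven_toPath y j)

/-- Both sides are choices and are compared componentwise. A blue component is the edge `x.1 n`, the
upper index of `x.1 (n + 1)`; the red components are left to `hred`. -/
theorem vert₁_res_succ_eq_vtx {n : ℕ} {x : G.Path} {y : Y} (h : (S.res n).vert₁ y = x.vtx n)
    (hred : ∀ (e : G.FEdge n) d, e ∈ G.red n → (S.res n).act e y d →
      ∃ f : G.FEdge (n + 1), G.sc (n + 1) f = x.vtx (n + 1) ∧ upper f = e) :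
    (S.res (n + 1)).vert₁ y = x.vtx (n + 1) := by
  refine Choice.eq_of_forall (H := G.res n) ?_ fun X hX => ?_
  · obtain ⟨a, ha, -⟩ := (S.res n).existsUnique_left h
    obtain rfl := S.eq_of_act_blue (x.2.1 n) ha
    refine ((S.res n).vert₀_eq ha).trans ?_
    rw [← x.upper_edge n]
    exact rg_upper (x.1 (n + 1))
  · obtain ⟨d, hd⟩ := (S.res n).exists_act_choice y hX
    rcases blue_or_red n _ with hb | hr
    · obtain rfl := S.eq_of_act_blue hb hd
      refine ⟨x.1 (n + 1), rfl, (x.upper_edge n).trans ?_⟩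
      exact G.blue_unique (x.2.1 _) hb (h.symm.trans ((S.res n).vert₁_eq hd))
    · exact hred _ d hr hd

/-- A map to the path space that intertwines the shifts is determined by its behaviour on the
layer `0`. -/
theorem eq_toPath {ψ : Y → G.Path} (hψ : ∀ y, ψ (ρ y) = G.shift (ψ y))
    (h0 : ∀ y, (S.res 0).vert₁ y = (ψ y).vtx 0)
    (hred : ∀ (e : G.FEdge 0) y d, e ∈ G.red 0 → (S.res 0).act e y d → (ψ y).redEven 0 = e) :
    ψ = S.toPath := by
  have step : ∀ j, (∀ y, (S.res (2 * j)).vert₁ y = (ψ y).vtx (2 * j)) →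
      (∀ (e : G.FEdge (2 * j)) y d, e ∈ G.red (2 * j) → (S.res (2 * j)).act e y d →
        (ψ y).redEven j = e) →
      ∀ y, (S.res (2 * j + 1)).vert₁ y = (ψ y).vtx (2 * j + 1) := fun j h1 h2 y =>
    S.vert₁_res_succ_eq_vtx (h1 y) fun e d he hd =>
      ⟨(ψ y).redOdd j, (ψ y).sc_redOdd j, h2 e y d he hd⟩
  have vtx_shift' : ∀ j d, G.sc (2 * (j + 1)) ((ψ d).redEven (j + 1)) =
      (ψ (ρ d)).vtx (2 * (j + 1)) := fun j d => by
    rw [hψ, Path.vtx_shift]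
  have key : ∀ j, (∀ y, (S.res (2 * j)).vert₁ y = (ψ y).vtx (2 * j)) ∧
      ∀ (e : G.FEdge (2 * j)) y d, e ∈ G.red (2 * j) → (S.res (2 * j)).act e y d →
        (ψ y).redEven j = e := by
    intro j
    induction j with
    | zero => exact ⟨h0, hred⟩
    | succ j ih =>
      have hodd := step j ih.1 ih.2
      have hup : ∀ (e : G.FEdge (2 * j + 1)) y d, e ∈ G.red (2 * j + 1) →
          (S.res (2 * j + 1)).act e y d → (ψ d).redOdd j = e := fun e y d he hd =>
        redEdge_eq he (((S.res (2 * j + 1)).vert₁_eq hd).symm.trans (hodd d))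
      have heven : ∀ y, (S.res (2 * (j + 1))).vert₁ y = (ψ y).vtx (2 * (j + 1)) := fun y =>
        S.vert₁_res_succ_eq_vtx (hodd y) fun e d he hd => by
          -- In an odd layer the red edge acts backwards, so the point is `ρ d`; the vertex of `ψ (ρ
          -- d)` is the source of `redEven (j + 1)` of `ψ d`.
          obtain rfl := S.eq_of_act_red_odd he hd
          exact ⟨(ψ d).redEven (j + 1), vtx_shift' j d,
            ((ψ d).upper_redEven j).trans (hup e _ d he hd)⟩
      refine ⟨heven, fun e y d he hd => ?_⟩
      obtain rfl := S.eq_of_act_red_even he hd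
      -- Sources agree by the vertex statement at `ρ y`, upper indices by the statement for the odd
      -- layer.
      refine edge_ext (n := 2 * j + 1) ?_ (((ψ y).upper_redEven j).trans
        (hup _ _ y (red_upper.2 he) (S.act_res_succ.1 hd).1))
      exact (vtx_shift' j y).trans
        ((heven (ρ y)).symm.trans ((S.res (2 * (j + 1))).vert₁_eq hd))
  funext y
  refine Path.ext_vtx_even fun j => ?_
  rw [vtx_toPath, (key j).1]

end ShiftSystem

theorem isUniversal_shift (lab : G.RedLabelling) :
    GenFiniteShiftGraph.IsUniversal.{u, v} G G.shift G.natZ (G.natW lab) := by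
  intro Y _ ρ hρ Z W h
  obtain ⟨S, hvert, hblue, hred⟩ := exists_shiftSystem lab hρ.isLocalHomeomorph h
  refine ⟨S.toPath, ⟨S.continuous_toPath, ?_, ?_, ?_⟩, ?_⟩
  · rintro e _ ⟨y, hy, rfl⟩
    exact mem_natZ_iff.2 ((S.vtx_toPath y 0).trans (hvert e y hy))
  · rintro e w k _ ⟨y, hy, rfl⟩
    rw [mem_natW_iff]
    have hact := S.act_redEven_toPath y 0
    have hlab := hred e w k y hy
    have hw : S.vert₀ y = w := (S.vert₀_eq hlab).trans (rg_lab lab e w k)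
    have hf : (S.toPath y).redEven 0 ∈ G.R (G.rg 0 ((S.toPath y).redEven 0)) :=
      (S.toPath y).redEven_mem 0
    rw [show G.rg 0 ((S.toPath y).redEven 0) = S.vert₀ y from (S.vert₀_eq hact).symm] at hf
    -- Exactly one edge of the red class acts on `y`, and both `redEven 0` and the labelled edge do.
    exact (S.existsUnique_edge y _ (G.R_mem _)).unique ⟨hf, _, hact⟩
      ⟨hw.symm ▸ (lab e w k).2.1, _, hlab⟩
  · exact funext fun y => (S.shift_toPath y).symm
  · rintro ψ ⟨-, hψ⟩
    have hcover : ∀ y, ∃ e, y ∈ Z e := fun y => mem_iUnion.1 (h.iUnion_Z.symm ▸ mem_univ y)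
    refine S.eq_toPath (fun y => congrFun hψ.comm y) (fun y => ?_) fun f y d hf hact => ?_
    · obtain ⟨e, he⟩ := hcover y
      have := mem_natZ_iff.1 (hψ.image_Z e (mem_image_of_mem ψ he))
      exact (hvert e y he).trans this.symm
    · obtain ⟨γ, hγ⟩ := hcover y
      have hy : y ∈ ⋃ e, ⋃ k, W e (G.r γ.1) k := by
        rw [h.iUnion_V]
        exact mem_iUnion.2 ⟨γ, mem_iUnion.2 ⟨rfl, hγ⟩⟩
      simp only [mem_iUnion] at hy
      obtain ⟨e, k, hy⟩ := hy
      rw [mem_natW_iff.1 (hψ.image_W e _ k (mem_image_of_mem ψ hy))]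
      have hv : S.vert₀ y = G.r γ.1 := S.vert₀_eq (hblue γ y hγ)
      have hf' : f ∈ G.R (G.rg 0 f) := hf
      rw [show G.rg 0 f = S.vert₀ y from (S.vert₀_eq hact).symm] at hf'
      exact (S.existsUnique_edge y _ (G.R_mem _)).unique
        ⟨hv.symm ▸ (lab e _ k).2.1, _, hred e _ k y hy⟩ ⟨hf', d, hact⟩

end GenFiniteShiftGraph

theorem theorem5p17 (G : GenFiniteShiftGraph.{u}) (lab : G.RedLabelling) :
    IsLHomeo G.shift ∧
      G.IsStructure G.shift G.natZ (G.natW lab) ∧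
      GenFiniteShiftGraph.IsUniversal.{u, v} G G.shift G.natZ (G.natW lab) :=
  ⟨GenFiniteShiftGraph.isLHomeo_shift, GenFiniteShiftGraph.isStructure_shift lab,
    GenFiniteShiftGraph.isUniversal_shift lab⟩
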